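/- Let $d\in\mathbb N$, $\mathbb T=\mathbb R/2\pi\mathbb Z$, and let $V\in C^\infty(\mathbb R^d\times\mathbb T^d;\mathbb R)$ be bounded together with all its partial derivatives. For $\varepsilon>0$ put $$H(p,q)=H_0(p)+\varepsilon V(p,q),\qquad H_0(p)=\sum_{j=1}^d \frac{p_j^2}{2}.$$ For $0<\delta<\frac12$, $0<\beta<1$ and $\varepsilon>0$, a function $Z:\mathbb R^d\times\mathbb T^d\to\mathbb R$ is said to be in normal form (with parameters $\delta,\beta$, at $\varepsilon$) if $$Z(p,q)=\sum_{k\in\mathbb Z^d,\ |k|\le K}\hat Z_k(p)\,e^{i k\cdot q},\qquad K=\lfloor \varepsilon^{-\beta}\rfloor+1,$$ where, for every $k\neq0$, $\hat Z_k(p)\ne 0$ implies $|p\cdot k|\le\varepsilon^{\delta}$. Here $|\cdot|$ is the Euclidean norm. Fix $0<b<\frac12$. Then there exist $\delta\in(0,\frac12)$ and $\beta\in(0,1)$, depending only on $d$ and $b$, such that for every real $M>0$ there exist $C_M,\varepsilon_M>0$ with the following property. For every $0<\varepsilon<\varepsilon_M$ there exist a canonical transformation $(p,q)=\mathcal T(\tilde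 p,\tilde q)$ of $\mathbb R^d\times\mathbb T^d$ (a $C^\infty$ diffeomorphism preserving $\sum_j dp_j\wedge dq_j$) and a Hamiltonian $H_Z=H_0+Z$, with $Z\in C^\infty(\mathbb R^d\times\mathbb T^d)$ in normal form with parameters $\delta,\beta$ at $\varepsilon$, such that 1. $|p-\tilde p|\le C_M\varepsilon^{b}$ for all $(\tilde p,\tilde q)\in\mathbb R^d\times\mathbb T^d$; 2. $\|H\circ\mathcal T-H_Z\|_{C^2(\mathbb R^d\times\mathbb T^d)}\le C_M\varepsilon^{M}$; 3. all solutions of the Hamilton equations of $H_Z$ exist for all times, and along each of them $|\tilde p(t)-\tilde p(0)|\le C_M\varepsilon^{b}$ for all $t\in\mathbb R$. -/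

import Mathlib

open scoped ContDiff

noncomputable section

namespace Nekhoroshev

/-- `ℝ^d` with its Euclidean norm. -/
abbrev Vec (d : ℕ) : Type := EuclideanSpace ℝ (Fin d)

/-- The universal cover of the phase space `ℝ^d × 𝕋^d`, `𝕋 = ℝ / 2πℤ`. A point is a pair `(p, q)`
with `p` the actions and `q` the angles; objects on `ℝ^d × 𝕋^d` are objects on the cover that are
compatible with the translations of `q` by `2πℤ^d`. -/
abbrev Phase (d : ℕ) : Type := Vec d × Vec d

/-- The vector `2πk`. -/
def latticeVec {d : ℕ} (k : Fin d → ℤ) : Vec d :=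
  WithLp.toLp 2 fun i => 2 * Real.pi * (k i : ℝ)

/-- The scalar product `k · v` of an integer vector with a real vector. -/
def dotInt {d : ℕ} (k : Fin d → ℤ) (v : Vec d) : ℝ := ∑ i, (k i : ℝ) * v i

/-- `f` descends to a function on `ℝ^d × 𝕋^d`. -/
def AnglePeriodic {d : ℕ} (f : Phase d → ℝ) : Prop :=
  ∀ (p q : Vec d) (k : Fin d → ℤ), f (p, q + latticeVec k) = f (p, q)

/-- `f` is bounded together with all its derivatives. -/
def BoundedDerivs {d : ℕ} (f : Phase d → ℝ) : Prop :=
  ∀ n : ℕ, ∃ C : ℝ, ∀ x, ‖iteratedFDeriv ℝ n f x‖ ≤ C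

/-- `sup_x ‖D^n f(x)‖ ≤ A` for `n = 0, 1, 2`. -/
def C2NormLE {d : ℕ} (f : Phase d → ℝ) (A : ℝ) : Prop :=
  ∀ n : ℕ, n ≤ 2 → ∀ x, ‖iteratedFDeriv ℝ n f x‖ ≤ A

/-- `H₀(p) = ∑ p_j² / 2`. -/
def freeH {d : ℕ} (x : Phase d) : ℝ := ∑ j, x.1 j ^ 2 / 2

/-- `H = H₀ + ε V`. -/
def perturbedH {d : ℕ} (ε : ℝ) (V : Phase d → ℝ) (x : Phase d) : ℝ := freeH x + ε * V x

/-- The standard symplectic form `∑ dp_j ∧ dq_j`. -/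
def symplForm {d : ℕ} (u v : Phase d) : ℝ := inner ℝ u.1 v.2 - inner ℝ u.2 v.1

/-- `T` is (the lift of) a canonical transformation of `ℝ^d × 𝕋^d`: a smooth diffeomorphism,
compatible with the translations of the angles, that preserves the symplectic form. -/
structure IsCanonical {d : ℕ} (T : Phase d → Phase d) : Prop where
  smooth : ContDiff ℝ ∞ T
  equivariant : ∀ (p q : Vec d) (k : Fin d → ℤ),
    T (p, q + latticeVec k) = T (p, q) + (0, latticeVec k)
  smooth_inverse : ∃ S : Phase d → Phase d,
    ContDiff ℝ ∞ S ∧ Function.LeftInverse S T ∧ Function.RightInverse S T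
  symplectic : ∀ x u v : Phase d,
    symplForm (fderiv ℝ T x u) (fderiv ℝ T x v) = symplForm u v

/-- The Hamiltonian vector field `(ṗ, q̇) = (-∂H/∂q, ∂H/∂p)`. -/
def hamField {d : ℕ} (H : Phase d → ℝ) (x : Phase d) : Phase d :=
  (-gradient (fun q => H (x.1, q)) x.2, gradient (fun p => H (p, x.2)) x.1)

/-- `γ` solves the Hamilton equations of `H` for all times. -/
def IsSolution {d : ℕ} (H : Phase d → ℝ) (γ : ℝ → Phase d) : Prop :=
  ∀ t : ℝ, HasDerivAt γ (hamField H (γ t)) t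

/-- The Fourier cutoff `K(ε) = ⌊ε^{-β}⌋ + 1`. -/
def cutoff (β ε : ℝ) : ℕ := ⌊1 / ε ^ β⌋₊ + 1

/-- The integer vectors of Euclidean length at most `K`. -/
def modes (d K : ℕ) : Finset (Fin d → ℤ) :=
  (Fintype.piFinset fun _ => Finset.Icc (-(K : ℤ)) K).filter fun k => ∑ i, k i ^ 2 ≤ (K : ℤ) ^ 2

/-- `Z` is in normal form with parameters `δ, β` at `ε`: it is a trigonometric polynomial in the
angles with frequencies `|k| ≤ K(ε)`, and for `k ≠ 0` its `k`-th Fourier coefficient `c k` is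
supported in the resonant region `|p · k| ≤ ε^δ`. -/
def IsNormalForm {d : ℕ} (δ β ε : ℝ) (Z : Phase d → ℝ) : Prop :=
  ∃ c : (Fin d → ℤ) → Vec d → ℂ,
    (∀ p q : Vec d, (Z (p, q) : ℂ) =
      ∑ k ∈ modes d (cutoff β ε), c k p * Complex.exp (Complex.I * (dotInt k q : ℂ))) ∧
    ∀ k ∈ modes d (cutoff β ε), k ≠ 0 → ∀ p : Vec d, c k p ≠ 0 → |dotInt k p| ≤ ε ^ δ

end Nekhoroshev

end

/-! The proof joins an analytic half, which builds the normal form, to a geometric half, which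
confines its flow. They share only the resonance width `ε ^ δ` and the cutoff `K ~ ε ^ (-β)`.

Analytic half. Put `p = r p'` with `r = ε ^ δ`. Up to the factor `r ^ 2` the Hamiltonian becomes `H₀
+ μ W` with `μ = ε ^ (1 - 2δ)` and `W (p, q) = V (r p, q)`. The resonant zones now have width one,
so a divisor `k · p` is inverted only away from `0`. Each derivative of the cutoffs costs one power
of `|k|`, which the rapid decay of Fourier modes of smooth functions absorbs. Hence the solution
operators of the homological equation preserve the property "all derivatives are `O(μ)` uniformly in
`ε`" (`UnifBdd.multiplier`), whatever `K` is; since only finitely many steps are needed, no finer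
account of derivatives is kept. Instead of composing many transformations, one looks for a single
generating function `S` with `H (p + ∂_q S, q) = H_Z (p, q + ∂_p S)`. This Hamilton–Jacobi equation
is a fixed-point problem with contraction factor `O(μ)` (`UnifBdd.hjRHS_sub`). After `n` iterations
its defect is at most of order `μ ^ n + K ^ (-N)`, hence `O(ε ^ M)` (`exists_hj_solution`). The
transformation generated by `S` (`exists_canonical`) moves the unscaled actions by `r * O(μ) = O(ε ^
(1 - δ))`.

Geometric half. Along the flow of `H_Z` the velocity of `p` lies in the span of the resonant `k`
(`inner_drift_eq_zero`). The frequency is `p` itself, so a motion inside a resonant space `M`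
changes the projection of `p` on `M` by its full length: a long motion would leave the resonance and
enter a region with fewer resonances, where the motion is shorter still. Induction on the
multiplicity (`norm_sub_le_of_no_resonance`) bounds the drift for all times by a constant times `K ^
((2d + 2) d) * ε ^ δ`, without energy conservation. The power of `K` comes from the quantitative
independence of integer vectors (`abs_coeff_le_of_linearIndependent`), and a small `β` makes it
harmless. -/

noncomputable section

namespace Nekhoroshev

/-! ### Geometry of resonances -/

/-- An integer vector, seen as a real vector. -/
def intVec {d : ℕ} (k : Fin d → ℤ) : Vec d := WithLp.toLp 2 fun i => (k i : ℝ)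

lemma inner_intVec {d : ℕ} (k : Fin d → ℤ) (v : Vec d) : inner ℝ (intVec k) v = dotInt k v := by
  simp [intVec, dotInt, PiLp.inner_apply, mul_comm]

lemma norm_intVec_le {d K : ℕ} {k : Fin d → ℤ} (hk : k ∈ modes d K) : ‖intVec k‖ ≤ K := by
  rw [modes, Finset.mem_filter] at hk
  rw [EuclideanSpace.norm_eq]
  apply Real.sqrt_le_iff.2 ⟨by positivity, ?_⟩
  have := hk.2
  simp only [intVec, Real.norm_eq_abs, sq_abs]
  exact_mod_cast this

lemma mem_modes_iff {d K : ℕ} {k : Fin d → ℤ} : k ∈ modes d K ↔ ‖intVec k‖ ≤ K := by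
  refine ⟨norm_intVec_le, fun h => ?_⟩
  have h2 : ∑ i, k i ^ 2 ≤ (K : ℤ) ^ 2 := by
    rw [EuclideanSpace.norm_eq, Real.sqrt_le_iff] at h
    have := h.2
    simp only [intVec, Real.norm_eq_abs, sq_abs] at this
    exact_mod_cast this
  rw [modes, Finset.mem_filter]
  refine ⟨?_, h2⟩
  rw [Fintype.mem_piFinset]
  intro i
  rw [Finset.mem_Icc, ← abs_le]
  apply abs_le_of_sq_le_sq _ (by positivity)
  exact (Finset.single_le_sum (f := fun i => k i ^ 2) (fun i _ => sq_nonneg _)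
    (Finset.mem_univ i)).trans h2

/-- Coefficients in a family of independent integer vectors of bounded length are controlled by
the norm of the combination: the Gram determinant is a nonzero integer. -/
lemma abs_coeff_le_of_linearIndependent {d : ℕ} {ι : Type*} [Fintype ι] [DecidableEq ι]
    (k : ι → Fin d → ℤ) {K : ℝ} (hK : 1 ≤ K) (hk : ∀ i, ‖intVec (k i)‖ ≤ K)
    (hli : LinearIndependent ℝ fun i => intVec (k i)) (c : ι → ℝ) (i : ι) :
    |c i| ≤ Fintype.card ι * ((Fintype.card ι).factorial * (K ^ 2) ^ Fintype.card ι) * K *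
      ‖∑ j, c j • intVec (k j)‖ := by
  set n := Fintype.card ι
  let G : Matrix ι ι ℤ := fun i j => ∑ l, k i l * k j l
  let R : Matrix ι ι ℝ := G.map (Int.castRingHom ℝ)
  have hR : ∀ i j, R i j = inner ℝ (intVec (k i)) (intVec (k j)) := by
    intro i j
    have : R i j = ((∑ l, k i l * k j l : ℤ) : ℝ) := rfl
    rw [this]
    simp [intVec, PiLp.inner_apply, mul_comm]
  have hmul : ∀ c : ι → ℝ, ∀ i, R.mulVec c i = inner ℝ (intVec (k i)) (∑ j, c j • intVec (k j)) := by
    intro c i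
    simp [Matrix.mulVec, dotProduct, hR, inner_sum, inner_smul_right, mul_comm]
  have hdetR : R.det = (G.det : ℝ) := by
    simp only [R]
    rw [← RingHom.mapMatrix_apply, ← RingHom.map_det]
    simp
  have hdet : R.det ≠ 0 := by
    intro h0
    obtain ⟨e, he, hz⟩ := Matrix.exists_mulVec_eq_zero_iff.2 h0
    apply he
    have hv : ∑ j, e j • intVec (k j) = 0 := by
      rw [← inner_self_eq_zero (𝕜 := ℝ)]
      conv_lhs => rw [sum_inner]
      apply Finset.sum_eq_zero
      intro j _
      rw [inner_smul_left, ← hmul, hz]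
      simp
    funext j
    exact Fintype.linearIndependent_iff.1 hli e hv j
  have hdet1 : 1 ≤ |R.det| := by
    rw [hdetR] at hdet ⊢
    have : G.det ≠ 0 := by exact_mod_cast hdet
    exact_mod_cast Int.one_le_abs this
  set v := ∑ j, c j • intVec (k j)
  -- Cramer's rule. The adjugate entries are determinants whose entries are at most `K ^ 2`, and the
  -- determinant on the left is at least `1` in absolute value.
  have hadj : R.det * c i = ∑ j, R.adjugate i j * inner ℝ (intVec (k j)) v := by
    have h1 : (R.adjugate * R).mulVec c = R.det • c := by
      rw [Matrix.adjugate_mul, Matrix.smul_mulVec, Matrix.one_mulVec]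
    have h2 := congrFun h1 i
    rw [← Matrix.mulVec_mulVec] at h2
    simp only [Pi.smul_apply, smul_eq_mul] at h2
    rw [← h2]
    simp only [Matrix.mulVec, dotProduct]
    apply Finset.sum_congr rfl
    intro j _
    rw [← hmul]
    rfl
  have hK2 : 1 ≤ K ^ 2 := one_le_pow₀ hK
  have hent : ∀ i j, |R.adjugate i j| ≤ n.factorial * (K ^ 2) ^ n := by
    intro i j
    rw [Matrix.adjugate_apply]
    have := Matrix.det_le (A := R.updateRow j (Pi.single i 1)) (abv := AbsoluteValue.abs)
      (x := K ^ 2) ?_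
    · simpa using this
    · intro a b
      rw [AbsoluteValue.abs_apply, Matrix.updateRow_apply]
      split_ifs
      · by_cases hb : b = i
        · subst hb; simpa using hK2
        · simp [Pi.single_eq_of_ne hb]; positivity
      · rw [hR]
        refine (abs_real_inner_le_norm _ _).trans ?_
        rw [sq]
        exact mul_le_mul (hk _) (hk _) (norm_nonneg _) (by linarith)
  calc |c i| ≤ |R.det| * |c i| := le_mul_of_one_le_left (abs_nonneg _) hdet1
    _ = |∑ j, R.adjugate i j * inner ℝ (intVec (k j)) v| := by rw [← abs_mul, hadj]
    _ ≤ ∑ j, |R.adjugate i j * inner ℝ (intVec (k j)) v| := Finset.abs_sum_le_sum_abs _ _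
    _ ≤ ∑ _j : ι, (n.factorial * (K ^ 2) ^ n) * (K * ‖v‖) := by
        apply Finset.sum_le_sum
        intro j _
        rw [abs_mul]
        apply mul_le_mul (hent _ _) _ (abs_nonneg _) (by positivity)
        exact (abs_real_inner_le_norm _ _).trans (by gcongr; exact hk j)
    _ = _ := by
        simp only [Finset.sum_const, Finset.card_univ, nsmul_eq_mul]
        ring

/-- `M` is spanned by integer vectors of length at most `K`. -/
def IsIntSpan {d : ℕ} (K : ℕ) (M : Submodule ℝ (Vec d)) : Prop :=
  ∃ s : Set (Vec d), (∀ v ∈ s, ∃ k ∈ modes d K, intVec k = v) ∧ M = Submodule.span ℝ s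

/-- The constant in the lower bound of the distance between an integer vector and an integer
subspace. -/
def sepConst (d K : ℕ) : ℝ := d * (d.factorial * ((K : ℝ) ^ 2) ^ d) * K

/-- A basis of `M` extracted from its integer generators stays independent when `k` is adjoined, so
the Gram determinant bound applies to the coefficient of `k`. Geometrically, `k` is at distance at
least `1 / sepConst d K` from `M`. -/
lemma abs_le_sepConst_mul_norm {d K : ℕ} (hK : 1 ≤ K) {M : Submodule ℝ (Vec d)}
    (hM : IsIntSpan K M) {k : Fin d → ℤ} (hk : k ∈ modes d K) (hkM : intVec k ∉ M)
    {m : Vec d} (hm : m ∈ M) (c : ℝ) : |c| ≤ sepConst d K * ‖m + c • intVec k‖ := by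
  classical
  obtain ⟨s, hs, rfl⟩ := hM
  obtain ⟨b, hbs, hspan, hli⟩ := exists_linearIndependent ℝ s
  have : Finite b := hli.finite
  have : Fintype b := Fintype.ofFinite b
  choose κ hκ hκe using fun v : b => hs v (hbs v.2)
  let k' : Option b → Fin d → ℤ := fun o => Option.casesOn' o k κ
  have hk' : ∀ o, k' o ∈ modes d K := by
    rintro (_ | v)
    · exact hk
    · exact hκ v
  have hfun : (fun o => intVec (k' o)) = fun o : Option b => Option.casesOn' o (intVec k) Subtype.val := by
    funext o
    cases o
    · rfl
    · simp [k', hκe]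
  have hli' : LinearIndependent ℝ fun o => intVec (k' o) := by
    rw [hfun, linearIndependent_option']
    refine ⟨hli, ?_⟩
    rwa [Subtype.range_coe, hspan]
  have hcard : Fintype.card (Option b) ≤ d := by
    simpa using hli'.fintype_card_le_finrank
  rw [← hspan] at hm
  obtain ⟨e, he⟩ := (Submodule.mem_span_range_iff_exists_fun ℝ (v := (Subtype.val : b → Vec d))).1
    (by rwa [Subtype.range_coe])
  have hK' : (1 : ℝ) ≤ K := by exact_mod_cast hK
  have := abs_coeff_le_of_linearIndependent k' hK' (fun o => norm_intVec_le (hk' o)) hli'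
    (fun o => Option.casesOn' o c e) none
  rw [Fintype.sum_option] at this
  simp only [Option.casesOn'_none, Option.casesOn'_some, k'] at this
  simp only [hκe, he] at this
  rw [add_comm] at this
  refine this.trans ?_
  apply mul_le_mul_of_nonneg_right _ (norm_nonneg _)
  rw [sepConst]
  have hf : (Fintype.card (Option b)).factorial ≤ d.factorial := Nat.factorial_le hcard
  have hp : ((K : ℝ) ^ 2) ^ Fintype.card (Option b) ≤ ((K : ℝ) ^ 2) ^ d :=
    pow_le_pow_right₀ (one_le_pow₀ hK') hcard
  gcongr

lemma IsIntSpan.sup_span {d K : ℕ} {M : Submodule ℝ (Vec d)} (hM : IsIntSpan K M)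
    {k : Fin d → ℤ} (hk : k ∈ modes d K) :
    IsIntSpan K (M ⊔ Submodule.span ℝ {intVec k}) := by
  obtain ⟨s, hs, rfl⟩ := hM
  refine ⟨s ∪ {intVec k}, ?_, (Submodule.span_union _ _).symm⟩
  rintro v (hv | rfl)
  · exact hs v hv
  · exact ⟨k, hk, rfl⟩

/-- Near-resonance with `M` and with one further `k` forces near-resonance with their sum. Test the
projection `v` against itself: `‖v‖ ^ 2 = ⟨p, v⟩`, and in `v = m + c k` both `m` and `c` are bounded
by multiples of `‖v‖` through `abs_le_sepConst_mul_norm`. -/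
lemma norm_starProjection_sup_le {d K : ℕ} (hK : 1 ≤ K) {M : Submodule ℝ (Vec d)}
    (hM : IsIntSpan K M) {k : Fin d → ℤ} (hk : k ∈ modes d K) (hkM : intVec k ∉ M)
    {p : Vec d} {σ x : ℝ} (hσ : ‖M.starProjection p‖ ≤ σ) (hx : |dotInt k p| ≤ x) :
    ‖(M ⊔ Submodule.span ℝ {intVec k}).starProjection p‖ ≤
      (1 + sepConst d K * K) * σ + sepConst d K * x := by
  set N := M ⊔ Submodule.span ℝ {intVec k}
  set A := sepConst d K
  have hA : 0 ≤ A := by unfold A sepConst; positivity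
  set v := N.starProjection p with hv
  have hvN : v ∈ N := Submodule.starProjection_apply_mem _ _
  obtain ⟨m, hm, y, hy, hmy⟩ := Submodule.mem_sup.1 hvN
  obtain ⟨c, rfl⟩ := Submodule.mem_span_singleton.1 hy
  have hc : |c| ≤ A * ‖v‖ := by
    rw [← hmy]; exact abs_le_sepConst_mul_norm hK hM hk hkM hm c
  have hσ0 : 0 ≤ σ := (norm_nonneg _).trans hσ
  have hx0 : 0 ≤ x := (abs_nonneg _).trans hx
  have hmn : ‖m‖ ≤ (1 + A * K) * ‖v‖ := by
    have : m = v - c • intVec k := by rw [← hmy]; abel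
    calc ‖m‖ ≤ ‖v‖ + ‖c • intVec k‖ := by rw [this]; exact norm_sub_le _ _
      _ ≤ ‖v‖ + (A * ‖v‖) * K := by
        rw [norm_smul, Real.norm_eq_abs]
        gcongr
        exact norm_intVec_le hk
      _ = _ := by ring
  have h1 : ‖v‖ ^ 2 = inner ℝ p v := by
    rw [← real_inner_self_eq_norm_sq]
    conv_lhs => rw [hv]
    rw [Submodule.inner_starProjection_left_eq_right, Submodule.starProjection_eq_self_iff.2 hvN]
  have h2 : inner ℝ p v ≤ σ * ‖m‖ + |c| * x := by
    rw [← hmy, inner_add_right, inner_smul_right]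
    have e1 : inner ℝ p m ≤ σ * ‖m‖ := by
      have : inner ℝ p m = inner ℝ (M.starProjection p) m := by
        rw [Submodule.inner_starProjection_left_eq_right, Submodule.starProjection_eq_self_iff.2 hm]
      rw [this]
      exact (real_inner_le_norm _ _).trans (by gcongr)
    have e2 : c * inner ℝ p (intVec k) ≤ |c| * x := by
      refine (le_abs_self _).trans ?_
      rw [abs_mul, real_inner_comm, inner_intVec]
      gcongr
    linarith
  have h3 : ‖v‖ * ‖v‖ ≤ ‖v‖ * ((1 + A * K) * σ + A * x) := by
    calc ‖v‖ * ‖v‖ = ‖v‖ ^ 2 := by ring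
      _ ≤ σ * ‖m‖ + |c| * x := h1 ▸ h2
      _ ≤ σ * ((1 + A * K) * ‖v‖) + (A * ‖v‖) * x := by gcongr
      _ = _ := by ring
  rcases (norm_nonneg v).eq_or_lt with h | h
  · rw [← h]; positivity
  · exact le_of_mul_le_mul_left h3 h

/-- Take `t` to be the first time at level `v` and `s` the last time before `t` at level `u`; in
between the values are trapped. -/
lemma exists_crossing {f : ℝ → ℝ} {a b u v : ℝ} (hf : ContinuousOn f (Set.Icc a b)) (hab : a ≤ b)
    (ha : f a ≤ u) (huv : u < v) (hb : v ≤ f b) :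
    ∃ s t, a ≤ s ∧ s ≤ t ∧ t ≤ b ∧ f s = u ∧ f t = v ∧
      ∀ x ∈ Set.Icc s t, u ≤ f x ∧ f x ≤ v := by
  have hclosed : IsClosed {x ∈ Set.Icc a b | f x = v} :=
    hf.preimage_isClosed_of_isClosed isClosed_Icc isClosed_singleton
  have hne : {x ∈ Set.Icc a b | f x = v}.Nonempty := by
    obtain ⟨x, hx, hxv⟩ := intermediate_value_Icc hab hf ⟨ha.trans huv.le, hb⟩
    exact ⟨x, hx, hxv⟩
  obtain ⟨t, ⟨htm, htv⟩, htl⟩ :=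
    (isCompact_Icc.of_isClosed_subset hclosed fun x hx => hx.1).exists_isLeast hne
  have hf2 : ContinuousOn f (Set.Icc a t) := hf.mono (Set.Icc_subset_Icc_right htm.2)
  have hle : ∀ x ∈ Set.Icc a t, f x ≤ v := by
    intro x hx
    by_contra! h
    obtain ⟨y, hy, hyv⟩ := intermediate_value_Icc hx.1 (hf2.mono (Set.Icc_subset_Icc_right hx.2))
      ⟨ha.trans huv.le, h.le⟩
    have : t ≤ y := htl ⟨⟨hy.1, hy.2.trans (hx.2.trans htm.2)⟩, hyv⟩
    have hxt : x = t := le_antisymm hx.2 (this.trans hy.2)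
    rw [hxt, htv] at h
    exact lt_irrefl _ h
  have hclosed2 : IsClosed {x ∈ Set.Icc a t | f x = u} :=
    hf2.preimage_isClosed_of_isClosed isClosed_Icc isClosed_singleton
  have hne2 : {x ∈ Set.Icc a t | f x = u}.Nonempty := by
    obtain ⟨x, hx, hxv⟩ := intermediate_value_Icc htm.1 hf2 ⟨ha, htv ▸ huv.le⟩
    exact ⟨x, hx, hxv⟩
  obtain ⟨s, ⟨hsm, hsu⟩, hsg⟩ :=
    (isCompact_Icc.of_isClosed_subset hclosed2 fun x hx => hx.1).exists_isGreatest hne2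
  refine ⟨s, t, hsm.1, hsm.2, htm.2, hsu, htv, fun x hx => ⟨?_, hle x ⟨hsm.1.trans hx.1, hx.2⟩⟩⟩
  by_contra! h
  obtain ⟨y, hy, hyu⟩ := intermediate_value_Icc hx.2
    (hf2.mono (Set.Icc_subset_Icc_left (hsm.1.trans hx.1))) ⟨h.le, htv ▸ huv.le⟩
  have : y ≤ s := hsg ⟨⟨hsm.1.trans (hx.1.trans hy.1), hy.2⟩, hyu⟩
  have hxs : x = s := le_antisymm (hy.1.trans this) hx.1
  rw [hxs, hsu] at h
  exact lt_irrefl _ h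

/-- The width of the resonant zones of order `s`. -/
def zoneWidth (d K : ℕ) (r : ℝ) (s : ℕ) : ℝ := (32 * (1 + sepConst d K * K)) ^ s * r

lemma zoneWidth_succ (d K : ℕ) (r : ℝ) (s : ℕ) :
    zoneWidth d K r (s + 1) = 32 * (1 + sepConst d K * K) * zoneWidth d K r s := by
  rw [zoneWidth, zoneWidth, pow_succ]; ring

/-- A curve whose velocity always lies in the span of the integer vectors resonant at the current
point, with no resonance of multiplicity more than `s` along the way, moves by a controlled
amount. -/
lemma norm_sub_le_of_no_resonance {d K : ℕ} (hK : 1 ≤ K) {r : ℝ} (hr : 0 < r)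
    {p p' : ℝ → Vec d} (hp : ∀ t, HasDerivAt p (p' t) t)
    (hdrift : ∀ t v, (∀ k ∈ modes d K, |dotInt k (p t)| ≤ r → inner ℝ (intVec k) v = 0) →
      inner ℝ (p' t) v = 0) (s : ℕ) :
    ∀ a b : ℝ, a ≤ b → (∀ t ∈ Set.Icc a b, ∀ M : Submodule ℝ (Vec d), IsIntSpan K M →
      s < Module.finrank ℝ M → zoneWidth d K r (Module.finrank ℝ M) < ‖M.starProjection (p t)‖) →
    ‖p b - p a‖ ≤ 4 * zoneWidth d K r s := by
  set A := sepConst d K with hAdef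
  have hA : 0 ≤ A := by rw [hAdef, sepConst]; positivity
  have hKr : (1 : ℝ) ≤ K := by exact_mod_cast hK
  have hw0 : ∀ s, 0 < zoneWidth d K r s := by
    intro s
    rw [zoneWidth, ← hAdef]; positivity
  have hcont : Continuous p := continuous_iff_continuousAt.2 fun t => (hp t).continuousAt
  -- If all resonances met on the way lie in `M`, every `v` orthogonal to `M` gives a conserved
  -- quantity `⟨p, v⟩`.
  have hmem : ∀ (M : Submodule ℝ (Vec d)) (a b : ℝ), a ≤ b →
      (∀ t ∈ Set.Icc a b, ∀ k ∈ modes d K, |dotInt k (p t)| ≤ r → intVec k ∈ M) →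
      p b - p a ∈ M := by
    intro M a b hab hk
    rw [← Submodule.orthogonal_orthogonal M, Submodule.mem_orthogonal']
    intro v hv
    have hd : ∀ t, HasDerivAt (fun t => inner ℝ (p t) v) (inner ℝ (p' t) v) t := fun t => by
      simpa using (hp t).inner ℝ (hasDerivAt_const t v)
    have := constant_of_has_deriv_right_zero (f := fun t => inner ℝ (p t) v) (a := a) (b := b)
      (fun t _ => (hd t).continuousAt.continuousWithinAt) (fun t ht => ?_) b ⟨hab, le_rfl⟩
    · rw [inner_sub_left, sub_eq_zero]; exact this
    · rw [← hdrift t v fun k hkm hkr => ?_]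
      · exact (hd t).hasDerivWithinAt
      · exact Submodule.inner_right_of_mem_orthogonal (hk t ⟨ht.1, ht.2.le⟩ k hkm hkr) hv
  induction s with
  | zero =>
    intro a b hab hno
    have h0 : p b - p a ∈ (⊥ : Submodule ℝ (Vec d)) := by
      apply hmem _ a b hab
      intro t ht k hk hkr
      by_contra hne
      have hbot : IsIntSpan K (⊥ : Submodule ℝ (Vec d)) := ⟨∅, by simp, by simp⟩
      have hpr := norm_starProjection_sup_le hK hbot hk hne (p := p t) (σ := 0) (by simp) hkr
      have hne' : intVec k ≠ 0 := by simpa using hne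
      have hfr : Module.finrank ℝ ↥((⊥ : Submodule ℝ (Vec d)) ⊔ Submodule.span ℝ {intVec k}) = 1 := by
        rw [bot_sup_eq]; exact finrank_span_singleton hne'
      have := hno t ht _ (hbot.sup_span hk) (by rw [hfr]; exact one_pos)
      rw [hfr, zoneWidth, pow_one, ← hAdef] at this
      have hAK : A ≤ A * K := le_mul_of_one_le_right hA hKr
      have hAr : A * r ≤ A * K * r := by gcongr
      nlinarith [mul_nonneg (mul_nonneg hA (zero_le_one.trans hKr)) hr.le]
    rw [Submodule.mem_bot] at h0
    rw [h0, norm_zero]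
    have := hw0 0
    positivity
  | succ s ih =>
    intro a b hab hno
    set w := zoneWidth d K r (s + 1) with hw
    have hws : zoneWidth d K r s ≤ w / 32 := by
      rw [hw, zoneWidth_succ, ← hAdef]
      have := hw0 s
      have : 0 ≤ A * K * zoneWidth d K r s := by positivity
      linarith
    have hwpos : 0 < w := hw0 _
    have hrw : r ≤ w := by
      rw [hw, zoneWidth]
      apply le_mul_of_one_le_left hr.le
      apply one_le_pow₀
      rw [← hAdef]
      nlinarith [mul_nonneg hA (zero_le_one.trans hKr)]
    by_cases hres : ∃ t ∈ Set.Icc a b, ∃ M : Submodule ℝ (Vec d), IsIntSpan K M ∧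
        Module.finrank ℝ M = s + 1 ∧ ‖M.starProjection (p t)‖ ≤ w
    swap
    · refine (ih a b hab ?_).trans (by linarith)
      intro t ht M hM hs
      rcases Nat.lt_or_ge (s + 1) (Module.finrank ℝ M) with h | h
      · exact hno t ht M hM h
      · have he : Module.finrank ℝ M = s + 1 := by omega
        rw [he]
        by_contra! hle
        exact hres ⟨t, ht, M, hM, he, hle⟩
    obtain ⟨t₀, ht₀, M, hM, hMs, hMw⟩ := hres
    set f : ℝ → ℝ := fun t => ‖M.starProjection (p t)‖ with hf
    have hfc : Continuous f := (M.starProjection.continuous.comp hcont).norm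
    -- Inside the zone of `M`, a nearly resonant `k` outside `M` would create a resonance of
    -- multiplicity at least `s + 2`, which `hno` forbids.
    have hsep : ∀ t ∈ Set.Icc a b, f t ≤ 2 * w → ∀ k ∈ modes d K, |dotInt k (p t)| ≤ K * w →
        intVec k ∈ M := by
      intro t ht hft k hk hkx
      by_contra hkM
      have h1 := norm_starProjection_sup_le hK hM hk hkM hft hkx
      have hfr : s + 1 < Module.finrank ℝ ↥(M ⊔ Submodule.span ℝ {intVec k}) := by
        rw [← hMs]
        apply Submodule.finrank_lt_finrank_of_lt
        apply lt_of_le_of_ne le_sup_left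
        intro he
        apply hkM
        rw [he]
        exact Submodule.mem_sup_right (Submodule.mem_span_singleton_self _)
      have h2 := hno t ht _ (hM.sup_span hk) hfr
      have h3 : zoneWidth d K r (s + 2) ≤
          zoneWidth d K r (Module.finrank ℝ ↥(M ⊔ Submodule.span ℝ {intVec k})) := by
        rw [zoneWidth, zoneWidth]
        gcongr ?_ ^ ?_ * _
        · rw [← hAdef]
          nlinarith [mul_nonneg hA (zero_le_one.trans hKr)]
        · omega
      have h4 : zoneWidth d K r (s + 2) = 32 * (1 + A * K) * w := by
        rw [zoneWidth_succ, ← hw]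
      have : 0 ≤ A * K * w := by positivity
      nlinarith
    have hrKw : r ≤ K * w := hrw.trans (le_mul_of_one_le_left hwpos.le hKr)
    have hmove : ∀ t₁ t₂, a ≤ t₁ → t₁ ≤ t₂ → t₂ ≤ b → (∀ t ∈ Set.Icc t₁ t₂, f t ≤ 2 * w) →
        p t₂ - p t₁ ∈ M := by
      intro t₁ t₂ h1 h2 h3 hft
      apply hmem M t₁ t₂ h2
      intro t ht k hk hkr
      exact hsep t ⟨h1.trans ht.1, ht.2.trans h3⟩ (hft t ht) k hk (hkr.trans hrKw)
    -- In the shell around the zone of `M` there is no resonance of multiplicity `s + 1` at all: by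
    -- `hsep` such an `M'` would coincide with `M`, and `w < f`. So the induction hypothesis
    -- applies, and the factor `32` in `zoneWidth` turns its bound into `w / 8`.
    have hsmall : ∀ t₁ t₂, a ≤ t₁ → t₁ ≤ t₂ → t₂ ≤ b →
        (∀ t ∈ Set.Icc t₁ t₂, w < f t ∧ f t ≤ 2 * w) → ‖p t₂ - p t₁‖ ≤ w / 8 := by
      intro t₁ t₂ h1 h2 h3 hft
      refine (ih t₁ t₂ h2 ?_).trans (by linarith)
      intro t ht M' hM' hs
      have htab : t ∈ Set.Icc a b := ⟨h1.trans ht.1, ht.2.trans h3⟩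
      rcases Nat.lt_or_ge (s + 1) (Module.finrank ℝ M') with h | h
      · exact hno t htab M' hM' h
      have he : Module.finrank ℝ M' = s + 1 := by omega
      rw [he]
      by_contra! hle
      have hMM : M' ≤ M := by
        obtain ⟨S, hS, rfl⟩ := hM'
        rw [Submodule.span_le]
        intro v hv
        obtain ⟨k, hk, rfl⟩ := hS v hv
        apply hsep t htab (hft t ht).2 k hk
        have hvM : intVec k ∈ Submodule.span ℝ S := Submodule.subset_span hv
        rw [← inner_intVec, ← Submodule.starProjection_eq_self_iff.2 hvM,
          Submodule.inner_starProjection_left_eq_right]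
        refine (abs_real_inner_le_norm _ _).trans ?_
        gcongr
        exact norm_intVec_le hk
      have : M' = M := Submodule.eq_of_le_of_finrank_eq hMM (by rw [he, hMs])
      subst this
      exact absurd hle (not_le.2 (hft t ht).1)
    have hdiff : ∀ t₁ t₂, f t₂ ≤ f t₁ + ‖p t₂ - p t₁‖ := by
      intro t₁ t₂
      have : M.starProjection (p t₂) = M.starProjection (p t₁) + M.starProjection (p t₂ - p t₁) := by
        rw [← map_add]; congr 1; abel
      simp only [hf]
      rw [this]
      exact (norm_add_le _ _).trans (by gcongr; exact Submodule.norm_starProjection_apply_le _ _)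
    -- Climbing from `5/4 w` to `3/2 w` takes a displacement of at least `w / 4`, while `hsmall`
    -- allows only `w / 8`. The zone of `M` is thus never left.
    have hbound : ∀ t ∈ Set.Icc a b, f t ≤ 3 / 2 * w := by
      intro t ht
      by_contra! hlt
      rcases le_total t₀ t with h | h
      · obtain ⟨x, y, hx, hxy, hy, hfx, hfy, hmid⟩ := exists_crossing (u := 5 / 4 * w)
          (v := 3 / 2 * w) hfc.continuousOn h (hMw.trans (by linarith)) (by linarith) hlt.le
        have h1 := hsmall x y (ht₀.1.trans hx) hxy (hy.trans ht.2) fun t ht =>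
          ⟨by linarith [(hmid t ht).1], by linarith [(hmid t ht).2]⟩
        have := hdiff x y
        linarith
      -- Times before `t₀` are treated by reversing time.
      · obtain ⟨x, y, hx, hxy, hy, hfx, hfy, hmid⟩ := exists_crossing (f := fun t => f (-t))
          (u := 5 / 4 * w) (v := 3 / 2 * w) (hfc.comp continuous_neg).continuousOn (neg_le_neg h)
          (by simpa using hMw.trans (by linarith)) (by linarith) (by simpa using hlt.le)
        have h1 := hsmall (-y) (-x) (by linarith [ht.1]) (by linarith) (by linarith [ht₀.2])
          fun t ht => by
            have := hmid (-t) ⟨by linarith [ht.2], by linarith [ht.1]⟩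
            simp only [neg_neg] at this
            exact ⟨by linarith [this.1], by linarith [this.2]⟩
        have := hdiff (-x) (-y)
        rw [norm_sub_rev] at this
        linarith
    -- The whole displacement lies in `M`, so it is the difference of the projections at the two
    -- ends, each at most `3/2 w`.
    have hin := hmove a b le_rfl hab le_rfl fun t ht => (hbound t ht).trans (by linarith)
    rw [← Submodule.starProjection_eq_self_iff.2 hin, map_sub]
    refine (norm_sub_le _ _).trans ?_
    have h1 := hbound a ⟨le_rfl, hab⟩
    have h2 := hbound b ⟨hab, le_rfl⟩
    simp only [hf] at h1 h2
    linarith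

/-- A curve whose velocity always lies in the span of the integer vectors resonant at the current
point stays close to its starting point for all times. -/
lemma exists_drift_bound (d : ℕ) : ∃ C : ℝ, 0 < C ∧ ∀ (K : ℕ), 1 ≤ K → ∀ r : ℝ, 0 < r →
    ∀ p p' : ℝ → Vec d, (∀ t, HasDerivAt p (p' t) t) →
    (∀ t v, (∀ k ∈ modes d K, |dotInt k (p t)| ≤ r → inner ℝ (intVec k) v = 0) →
      inner ℝ (p' t) v = 0) →
    ∀ t, ‖p t - p 0‖ ≤ C * (K : ℝ) ^ ((2 * d + 2) * d) * r := by
  refine ⟨4 * (32 * (1 + d * d.factorial)) ^ d, by positivity, ?_⟩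
  intro K hK r hr p p' hp hdrift t
  -- No subspace has dimension above `d`, so the inductive bound holds at level `s = d` on every
  -- interval.
  have hno : ∀ t : ℝ, ∀ M : Submodule ℝ (Vec d), IsIntSpan K M →
      d < Module.finrank ℝ M → zoneWidth d K r (Module.finrank ℝ M) < ‖M.starProjection (p t)‖ := by
    intro t M _ h
    have := Submodule.finrank_le M
    simp at this
    omega
  have hKr : (1 : ℝ) ≤ K := by exact_mod_cast hK
  have hb : 4 * zoneWidth d K r d ≤
      4 * (32 * (1 + d * d.factorial)) ^ d * (K : ℝ) ^ ((2 * d + 2) * d) * r := by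
    have h1 : 1 + sepConst d K * K ≤ (1 + d * d.factorial) * (K : ℝ) ^ (2 * d + 2) := by
      have : (1 : ℝ) ≤ (K : ℝ) ^ (2 * d + 2) := one_le_pow₀ hKr
      have e : sepConst d K * K = d * d.factorial * (K : ℝ) ^ (2 * d + 2) := by
        rw [sepConst, ← pow_mul]; ring
      rw [e]; linarith
    have h0 : 0 ≤ sepConst d K := by rw [sepConst]; positivity
    rw [zoneWidth, pow_mul, mul_assoc 4, ← mul_pow, ← mul_assoc]
    gcongr 4 * ?_ ^ d * r
    linarith
  refine le_trans ?_ hb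
  rcases le_total 0 t with h | h
  · exact norm_sub_le_of_no_resonance hK hr hp hdrift d 0 t h fun t _ => hno t
  · rw [norm_sub_rev]
    exact norm_sub_le_of_no_resonance hK hr hp hdrift d t 0 h fun t _ => hno t

end Nekhoroshev

end

noncomputable section

namespace Nekhoroshev

/-! ### Families of smooth functions with uniformly bounded derivatives -/

open scoped NNReal

section UnifBdd

variable {ι : Type} {X F G E : Type} [NormedAddCommGroup X] [NormedSpace ℝ X]
  [NormedAddCommGroup F] [NormedSpace ℝ F] [NormedAddCommGroup G] [NormedSpace ℝ G]
  [NormedAddCommGroup E] [NormedSpace ℝ E]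

/-- The `n`-th derivatives of the functions `f i` are `O(η i)`. -/
def BddDeriv (n : ℕ) (f : ι → X → F) (η : ι → ℝ≥0) : Prop :=
  ∃ C : ℝ≥0, ∀ i x, ‖iteratedFDeriv ℝ n (f i) x‖ ≤ C * η i

/-- The functions `f i` are smooth and all their derivatives are `O(η i)`. -/
structure UnifBdd (f : ι → X → F) (η : ι → ℝ≥0) : Prop where
  smooth : ∀ i, ContDiff ℝ ∞ (f i)
  bdd : ∀ n, BddDeriv n f η

/-- Leibniz' rule. It is stated at a fixed order, with bounds on orders `≤ n` only, because it
serves inside inductions on the order and for factors whose size `η` must depend on `n`. -/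
lemma BddDeriv.bilin {n : ℕ} {f : ι → X → F} {g : ι → X → G} {η θ : ι → ℝ≥0}
    (B : F →L[ℝ] G →L[ℝ] E) (hfs : ∀ i, ContDiff ℝ ∞ (f i)) (hgs : ∀ i, ContDiff ℝ ∞ (g i))
    (hf : ∀ m ≤ n, BddDeriv m f η) (hg : ∀ m ≤ n, BddDeriv m g θ) :
    BddDeriv n (fun i x => B (f i x) (g i x)) (η * θ) := by
  choose! C hC using hf
  choose! D hD using hg
  refine ⟨‖B‖₊ * ∑ m ∈ Finset.range (n + 1), (n.choose m : ℝ≥0) * C m * D (n - m), fun i x => ?_⟩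
  refine (B.norm_iteratedFDeriv_le_of_bilinear (hfs i) (hgs i) x (n := n) (by
    exact_mod_cast le_top)).trans ?_
  push_cast
  rw [mul_assoc, Finset.sum_mul]
  refine mul_le_mul_of_nonneg_left (Finset.sum_le_sum fun m hm => ?_) (norm_nonneg B)
  have hm' : m ≤ n := by simpa [Nat.lt_succ_iff] using hm
  calc (n.choose m : ℝ) * ‖iteratedFDeriv ℝ m (f i) x‖ * ‖iteratedFDeriv ℝ (n - m) (g i) x‖
      ≤ n.choose m * (C m * η i) * (D (n - m) * θ i) := by
        gcongr
        · exact hC m hm' i x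
        · exact hD (n - m) (Nat.sub_le _ _) i x
    _ = _ := by simp only [Pi.mul_apply, NNReal.coe_mul]; ring

lemma BddDeriv.add {n : ℕ} {f g : ι → X → F} {η : ι → ℝ≥0}
    (hfs : ∀ i, ContDiff ℝ ∞ (f i)) (hgs : ∀ i, ContDiff ℝ ∞ (g i))
    (hf : BddDeriv n f η) (hg : BddDeriv n g η) : BddDeriv n (fun i x => f i x + g i x) η := by
  obtain ⟨C, hC⟩ := hf
  obtain ⟨D, hD⟩ := hg
  refine ⟨C + D, fun i x => ?_⟩
  have : iteratedFDeriv ℝ n (fun x => f i x + g i x) x =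
      iteratedFDeriv ℝ n (f i) x + iteratedFDeriv ℝ n (g i) x :=
    iteratedFDeriv_add_apply ((hfs i).contDiffAt.of_le (by exact_mod_cast le_top))
      ((hgs i).contDiffAt.of_le (by exact_mod_cast le_top))
  rw [this]
  push_cast
  rw [add_mul]
  exact (norm_add_le _ _).trans (add_le_add (hC i x) (hD i x))

lemma bddDeriv_succ_iff {n : ℕ} {f : ι → X → F} {η : ι → ℝ≥0} :
    BddDeriv (n + 1) f η ↔ BddDeriv n (fun i => fderiv ℝ (f i)) η := by
  simp only [BddDeriv, norm_iteratedFDeriv_fderiv]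

namespace UnifBdd

variable {f : ι → X → F} {g : ι → X → G} {η θ : ι → ℝ≥0}

lemma bilin (B : F →L[ℝ] G →L[ℝ] E) (hf : UnifBdd f η) (hg : UnifBdd g θ) :
    UnifBdd (fun i x => B (f i x) (g i x)) (η * θ) where
  smooth i := B.isBoundedBilinearMap.contDiff.comp ((hf.smooth i).prodMk (hg.smooth i))
  bdd _ := BddDeriv.bilin B hf.smooth hg.smooth (fun m _ => hf.bdd m) fun m _ => hg.bdd m

lemma add {g : ι → X → F} (hf : UnifBdd f η) (hg : UnifBdd g η) :
    UnifBdd (fun i x => f i x + g i x) η where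
  smooth i := (hf.smooth i).add (hg.smooth i)
  bdd n := (hf.bdd n).add hf.smooth hg.smooth (hg.bdd n)

lemma clm (L : F →L[ℝ] G) (hf : UnifBdd f η) : UnifBdd (fun i x => L (f i x)) η where
  smooth i := L.contDiff.comp (hf.smooth i)
  bdd n := by
    obtain ⟨C, hC⟩ := hf.bdd n
    refine ⟨‖L‖₊ * C, fun i x => ?_⟩
    refine (L.norm_iteratedFDeriv_comp_left (hf.smooth i).contDiffAt (n := n)
      (by exact_mod_cast le_top)).trans ?_
    push_cast
    rw [mul_assoc]
    gcongr
    exact hC i x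

lemma neg (hf : UnifBdd f η) : UnifBdd (fun i x => -f i x) η := by
  simpa using hf.clm (-ContinuousLinearMap.id ℝ F)

lemma sub {g : ι → X → F} (hf : UnifBdd f η) (hg : UnifBdd g η) :
    UnifBdd (fun i x => f i x - g i x) η := by
  simpa [sub_eq_add_neg] using hf.add hg.neg

lemma mono (hf : UnifBdd f η) {c : ℝ≥0} (h : ∀ i, η i ≤ c * θ i) : UnifBdd f θ where
  smooth := hf.smooth
  bdd n := by
    obtain ⟨C, hC⟩ := hf.bdd n
    refine ⟨C * c, fun i x => (hC i x).trans ?_⟩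
    push_cast
    rw [mul_assoc]
    gcongr
    exact_mod_cast h i

lemma mono_le (hf : UnifBdd f η) (h : η ≤ θ) : UnifBdd f θ :=
  hf.mono (c := 1) fun i => by simpa using h i

/-- Multiplication by scalars depending on the index only. -/
lemma smul_const (hf : UnifBdd f η) (c : ι → ℝ≥0) :
    UnifBdd (fun i x => (c i : ℝ) • f i x) (c * η) where
  smooth i := (hf.smooth i).const_smul _
  bdd n := by
    obtain ⟨C, hC⟩ := hf.bdd n
    refine ⟨C, fun i x => ?_⟩
    have : iteratedFDeriv ℝ n (fun x => (c i : ℝ) • f i x) x = (c i : ℝ) • iteratedFDeriv ℝ n (f i) x :=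
      iteratedFDeriv_const_smul_apply ((hf.smooth i).contDiffAt.of_le (by exact_mod_cast le_top))
    rw [this, norm_smul]
    simp only [Pi.mul_apply, NNReal.coe_mul, Real.norm_eq_abs, NNReal.abs_eq]
    calc (c i : ℝ) * _ ≤ c i * (C * η i) := by gcongr; exact hC i x
      _ = _ := by ring

lemma fderiv (hf : UnifBdd f η) : UnifBdd (fun i => _root_.fderiv ℝ (f i)) η where
  smooth i := (hf.smooth i).fderiv_right (by simp)
  bdd n := bddDeriv_succ_iff.1 (hf.bdd (n + 1))

lemma const (c : F) : UnifBdd (fun (_ : ι) (_ : X) => c) 1 where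
  smooth _ := contDiff_const
  bdd n := by
    rcases n with _ | n
    · exact ⟨‖c‖₊, fun i x => by simp⟩
    · exact ⟨0, fun i x => by simp [iteratedFDeriv_const_of_ne (𝕜 := ℝ) (Nat.succ_ne_zero n) c]⟩

lemma norm_le (hf : UnifBdd f η) : ∃ C : ℝ≥0, ∀ i x, ‖f i x‖ ≤ C * η i := by
  simpa [BddDeriv] using hf.bdd 0

lemma norm_fderiv_le (hf : UnifBdd f η) :
    ∃ C : ℝ≥0, ∀ i x, ‖_root_.fderiv ℝ (f i) x‖ ≤ C * η i := hf.fderiv.norm_le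

variable {u v : ι → X → X}

/-- By the Faà di Bruno bound only derivatives of order at least one of `x + u i x` matter; the
unbounded map itself does not enter. -/
lemma comp_id_add (hf : UnifBdd f η) (hu : UnifBdd u 1) :
    UnifBdd (fun i x => f i (x + u i x)) η where
  smooth i := (hf.smooth i).comp (contDiff_id.add (hu.smooth i))
  bdd n := by
    have hD : ∀ m, 1 ≤ m → BddDeriv m (fun i x => x + u i x) (1 : ι → ℝ≥0) := by
      intro m hm
      obtain ⟨m, rfl⟩ : ∃ l, m = l + 1 := ⟨m - 1, by omega⟩
      rw [bddDeriv_succ_iff]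
      have : (fun i => _root_.fderiv ℝ fun x => x + u i x) =
          fun i x => ContinuousLinearMap.id ℝ X + _root_.fderiv ℝ (u i) x := by
        funext i x
        rw [fderiv_fun_add differentiableAt_fun_id ((hu.smooth i).differentiable (by simp) x)]
        simp
      rw [this]
      exact ((const _).add hu.fderiv).bdd m
    choose C hC using hf.bdd
    choose! D hD using hD
    let C' := ∑ m ∈ Finset.range (n + 1), C m
    -- The summand `1` ensures `D' ≤ D' ^ m`, the geometric form of bound required by the
    -- composition estimate.
    let D' := 1 + ∑ m ∈ Finset.range (n + 1), D m
    refine ⟨n.factorial * C' * D' ^ n, fun i x => ?_⟩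
    have := norm_iteratedFDeriv_comp_le (hf.smooth i) (contDiff_id.add (hu.smooth i))
      (n := n) (by exact_mod_cast le_top) x (C := C' * η i) (D := D') ?_ ?_
    · refine this.trans (le_of_eq ?_)
      push_cast
      ring
    · intro m hm
      refine (hC m i _).trans ?_
      gcongr
      exact Finset.single_le_sum (f := C) (fun _ _ => zero_le) (by simpa [Nat.lt_succ_iff] using hm)
    · intro m h1 hm
      have h2 := hD m h1 i x
      simp only [Pi.one_apply, NNReal.coe_one, mul_one] at h2
      refine h2.trans ?_
      have h3 : D m ≤ D' := (Finset.single_le_sum (f := D) (fun _ _ => zero_le)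
        (by simpa [Nat.lt_succ_iff] using hm)).trans (le_add_of_nonneg_left zero_le)
      have h4 : D' ≤ D' ^ m := le_self_pow₀ (le_add_of_nonneg_right zero_le) (by omega)
      exact_mod_cast h3.trans h4

/-- Induction on the order: the derivative of the difference is `(Df(x+u) - Df(x+v)) ∘ (1 + Du) +
Df(x+v) ∘ D(u-v)`, whose first term is the same kind of difference for `Df`. The target space
changes with each derivative, hence `F` is quantified inside the induction; order zero is the mean
value inequality. -/
lemma bddDeriv_comp_sub (hu : UnifBdd u 1) (hv : UnifBdd v 1)
    (huv : UnifBdd (fun i x => u i x - v i x) θ) (n : ℕ) :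
    ∀ {F : Type} [NormedAddCommGroup F] [NormedSpace ℝ F] {f : ι → X → F}, UnifBdd f η →
    BddDeriv n (fun i x => f i (x + u i x) - f i (x + v i x)) (η * θ) := by
  induction n using Nat.strong_induction_on with
  | _ n ih =>
    intro F _ _ f hf
    rcases n with _ | n
    · obtain ⟨C, hC⟩ := hf.norm_fderiv_le
      obtain ⟨D, hD⟩ := huv.norm_le
      refine ⟨C * D, fun i x => ?_⟩
      rw [norm_iteratedFDeriv_zero]
      refine (convex_univ.norm_image_sub_le_of_norm_fderiv_le (𝕜 := ℝ)
        (fun y _ => (hf.smooth i).differentiable (by simp) y) (fun y _ => hC i y)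
        (Set.mem_univ _) (Set.mem_univ _)).trans ?_
      rw [add_sub_add_left_eq_sub]
      calc (C : ℝ) * η i * ‖u i x - v i x‖ ≤ C * η i * (D * θ i) := by gcongr; exact hD i x
        _ = _ := by simp; ring
    · rw [bddDeriv_succ_iff]
      have hcomp : ∀ w : ι → X → X, UnifBdd w 1 → ∀ i x,
          HasFDerivAt (fun x => f i (x + w i x)) ((_root_.fderiv ℝ (f i) (x + w i x)).comp
            (ContinuousLinearMap.id ℝ X + _root_.fderiv ℝ (w i) x)) x := fun w hw i x =>
        (((hf.smooth i).differentiable (by simp) _).hasFDerivAt).comp x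
          ((hasFDerivAt_id x).add ((hw.smooth i).differentiable (by simp) x).hasFDerivAt)
      have heq : (fun i => _root_.fderiv ℝ fun x => f i (x + u i x) - f i (x + v i x)) =
          fun i x =>
            ContinuousLinearMap.compL ℝ X X F
              (_root_.fderiv ℝ (f i) (x + u i x) - _root_.fderiv ℝ (f i) (x + v i x))
              (ContinuousLinearMap.id ℝ X + _root_.fderiv ℝ (u i) x) +
            ContinuousLinearMap.compL ℝ X X F (_root_.fderiv ℝ (f i) (x + v i x))
              (_root_.fderiv ℝ (fun x => u i x - v i x) x) := by
        funext i x
        rw [((hcomp u hu i x).fun_sub (hcomp v hv i x)).fderiv,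
          fderiv_fun_sub ((hu.smooth i).differentiable (by simp) x)
            ((hv.smooth i).differentiable (by simp) x)]
        ext y
        simp
        abel
      rw [heq]
      have hDu : UnifBdd (fun i x => ContinuousLinearMap.id ℝ X + _root_.fderiv ℝ (u i) x) 1 :=
        (const _).add hu.fderiv
      have hfd := hf.fderiv
      have hs : ∀ i, ContDiff ℝ ∞ fun x =>
          _root_.fderiv ℝ (f i) (x + u i x) - _root_.fderiv ℝ (f i) (x + v i x) := fun i =>
        ((hfd.comp_id_add hu).smooth i).sub ((hfd.comp_id_add hv).smooth i)
      have h2 := (hfd.comp_id_add hv).bilin (ContinuousLinearMap.compL ℝ X X F) huv.fderiv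
      refine BddDeriv.add (fun i => ?_) h2.smooth ?_ (h2.bdd n)
      · exact (ContinuousLinearMap.compL ℝ X X F).isBoundedBilinearMap.contDiff.comp
          ((hs i).prodMk (hDu.smooth i))
      · have := BddDeriv.bilin (ContinuousLinearMap.compL ℝ X X F) hs hDu.smooth
          (fun m hm => ih m (by omega) hfd) (fun m (_ : m ≤ n) => hDu.bdd m)
        simpa using this

/-- Composition with near-identity maps depends in a Lipschitz way on the map. -/
lemma comp_sub (hf : UnifBdd f η) (hu : UnifBdd u 1) (hv : UnifBdd v 1)
    (huv : UnifBdd (fun i x => u i x - v i x) θ) :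
    UnifBdd (fun i x => f i (x + u i x) - f i (x + v i x)) (η * θ) where
  smooth i := ((hf.comp_id_add hu).smooth i).sub ((hf.comp_id_add hv).smooth i)
  bdd n := bddDeriv_comp_sub hu hv huv n hf

end UnifBdd

end UnifBdd

end Nekhoroshev

end

noncomputable section

namespace Nekhoroshev

open scoped NNReal

/-! ### Fourier projections in the angles -/

open MeasureTheory UnitAddTorus

local instance : MeasureSpace UnitAddCircle := ⟨AddCircle.haarAddCircle⟩

local instance : Measure.IsAddHaarMeasure (volume : Measure UnitAddCircle) :=
  inferInstanceAs (Measure.IsAddHaarMeasure AddCircle.haarAddCircle)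

section Fourier

set_option linter.unusedSectionVars false

variable {d : ℕ} {E : Type} [NormedAddCommGroup E] [NormedSpace ℝ E] [NormedSpace ℂ E]
  [IsScalarTower ℝ ℂ E] [CompleteSpace E]

/-- `f` is `2πℤ^d`-periodic in the angles. -/
def PeriodicAng {d : ℕ} {E : Type} (f : Phase d → E) : Prop :=
  ∀ (x : Phase d) (k : Fin d → ℤ), f (x + (0, latticeVec k)) = f x

/-- The translation by the angles `2πy`. -/
def angle (y : Fin d → ℝ) : Phase d := (0, WithLp.toLp 2 fun i => 2 * Real.pi * y i)

lemma angle_add (y z : Fin d → ℝ) : angle (y + z) = angle y + angle z := by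
  ext i
  · simp [angle]
  · simp [angle, mul_add]

lemma continuous_angle : Continuous (angle (d := d)) := by
  unfold angle
  fun_prop

/-- The point of the torus with representative `y`. -/
def torusMk (y : Fin d → ℝ) : UnitAddTorus (Fin d) := fun i => (y i : UnitAddCircle)

lemma continuous_torusMk : Continuous (torusMk (d := d)) :=
  continuous_pi fun i => (AddCircle.continuous_mk' 1).comp (continuous_apply i)

/-- The unit cube. -/
def unitCube (d : ℕ) : Set (Fin d → ℝ) := {y | ∀ i, y i ∈ Set.Ioc ((0 : Fin d → ℝ) i)
  ((0 : Fin d → ℝ) i + 1)}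

/-- The projection of `f` on the `k`-th Fourier mode in the angles. -/
def fproj (k : Fin d → ℤ) (f : Phase d → E) (x : Phase d) : E :=
  ∫ y in unitCube d, mFourier (-k) (torusMk y) • f (x + angle y)

lemma unitCube_eq : unitCube d = Set.pi Set.univ fun _ => Set.Ioc 0 1 := by
  ext y
  simp [unitCube]

lemma volume_unitCube : (volume : Measure (Fin d → ℝ)) (unitCube d) = 1 := by
  rw [unitCube_eq, volume_pi_pi]
  simp

local instance : IsProbabilityMeasure ((volume : Measure (Fin d → ℝ)).restrict (unitCube d)) :=
  ⟨by rw [Measure.restrict_apply_univ, volume_unitCube]⟩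

lemma norm_mFourier_apply (k : Fin d → ℤ) (τ : UnitAddTorus (Fin d)) : ‖mFourier k τ‖ = 1 := by
  simp [mFourier, fourier_apply, Circle.norm_coe]

lemma continuous_fproj_integrand (k : Fin d → ℤ) {f : Phase d → E} (hf : Continuous f)
    (x : Phase d) : Continuous fun y => mFourier (-k) (torusMk y) • f (x + angle y) :=
  ((mFourier (-k)).continuous.comp continuous_torusMk).smul
    (hf.comp (continuous_const.add continuous_angle))

lemma integrableOn_fproj_integrand (k : Fin d → ℤ) {f : Phase d → E} (hf : Continuous f)
    (x : Phase d) :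
    IntegrableOn (fun y => mFourier (-k) (torusMk y) • f (x + angle y)) (unitCube d) := by
  apply ((continuous_fproj_integrand k hf x).continuousOn.integrableOn_compact
    (isCompact_Icc (a := (0 : Fin d → ℝ)) (b := 1))).mono_set
  intro y hy
  exact ⟨fun i => (hy i).1.le, fun i => by simpa using (hy i).2⟩

lemma norm_fproj_le (k : Fin d → ℤ) {f : Phase d → E} {C : ℝ} (hC : ∀ x, ‖f x‖ ≤ C)
    (x : Phase d) : ‖fproj k f x‖ ≤ C := by
  refine (norm_integral_le_of_norm_le_const (C := C) (Filter.Eventually.of_forall fun y => ?_)).trans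
    (by simp)
  rw [norm_smul, norm_mFourier_apply, one_mul]
  exact hC _

/-- Since `fproj` averages translates of `f`, it commutes with differentiation. This is why general
vector values `E` are allowed: derivatives of projections are projections of derivatives. -/
lemma hasFDerivAt_fproj (k : Fin d → ℤ) {f : Phase d → E} (hf : ContDiff ℝ 1 f) {C : ℝ}
    (hC : ∀ x, ‖fderiv ℝ f x‖ ≤ C) (x : Phase d) :
    HasFDerivAt (fproj k f) (fproj k (fderiv ℝ f) x) x := by
  have hf' : Continuous (fderiv ℝ f) := hf.continuous_fderiv one_ne_zero
  apply hasFDerivAt_integral_of_dominated_of_fderiv_le (bound := fun _ => C)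
    (F' := fun x y => mFourier (-k) (torusMk y) • fderiv ℝ f (x + angle y)) Filter.univ_mem
  · exact Filter.Eventually.of_forall fun x =>
      (continuous_fproj_integrand k hf.continuous x).aestronglyMeasurable
  · exact integrableOn_fproj_integrand k hf.continuous x
  · exact (continuous_fproj_integrand k hf' x).aestronglyMeasurable
  · refine Filter.Eventually.of_forall fun y z _ => ?_
    rw [norm_smul, norm_mFourier_apply, one_mul]
    exact hC _
  · exact integrable_const _
  · refine Filter.Eventually.of_forall fun y z _ => ?_
    have h1 : HasFDerivAt (fun z => f (z + angle y)) (fderiv ℝ f (z + angle y)) z := by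
      rw [hasFDerivAt_comp_add_right]
      exact (hf.differentiable one_ne_zero _).hasFDerivAt
    exact h1.const_smul (mFourier (-k) (torusMk y))

lemma fproj_clm {E' : Type} [NormedAddCommGroup E'] [NormedSpace ℝ E'] [NormedSpace ℂ E']
    [CompleteSpace E'] (L : E →L[ℝ] E') (hL : ∀ (c : ℂ) (e : E), L (c • e) = c • L e)
    (k : Fin d → ℤ) {f : Phase d → E} (hf : Continuous f) (x : Phase d) :
    fproj k (fun x => L (f x)) x = L (fproj k f x) := by
  rw [fproj, fproj, ← ContinuousLinearMap.integral_comp_comm L (integrableOn_fproj_integrand k hf x)]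
  simp [hL]

/-! #### Descent to the torus -/

/-- The function on the torus induced by `f` on the angles around `x`. -/
def descend (f : Phase d → E) (x : Phase d) (τ : UnitAddTorus (Fin d)) : E :=
  f (x + angle fun i => (AddCircle.equivIoc 1 0 (τ i)).1)

lemma descend_torusMk {f : Phase d → E} (hf : PeriodicAng f) (x : Phase d) (y : Fin d → ℝ) :
    descend f x (torusMk y) = f (x + angle y) := by
  have h : ∀ i, ∃ n : ℤ, (AddCircle.equivIoc (1 : ℝ) 0 (torusMk y i)).1 = y i + n := by
    intro i
    have h1 : ((AddCircle.equivIoc (1 : ℝ) 0 (torusMk y i)).1 : UnitAddCircle) = (y i : UnitAddCircle) :=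
      (AddCircle.equivIoc (1 : ℝ) 0).symm_apply_apply (torusMk y i)
    rw [QuotientAddGroup.eq, AddSubgroup.mem_zmultiples_iff] at h1
    obtain ⟨n, hn⟩ := h1
    refine ⟨-n, ?_⟩
    simp only [zsmul_eq_mul, mul_one] at hn
    push_cast
    linarith
  choose n hn using h
  rw [descend, ← hf (x + angle y) n, add_assoc]
  congr 2
  ext i
  · simp [angle]
  · simp [angle, latticeVec, hn]
    ring

lemma continuous_descend {f : Phase d → E} (hf : PeriodicAng f) (hc : Continuous f)
    (x : Phase d) : Continuous (descend f x) := by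
  have hq : IsOpenQuotientMap (torusMk (d := d)) :=
    IsOpenQuotientMap.piMap fun _ => QuotientAddGroup.isOpenQuotientMap_mk
  rw [← hq.continuous_comp_iff]
  have : descend f x ∘ torusMk = fun y => f (x + angle y) :=
    funext fun y => descend_torusMk hf x y
  rw [this]
  exact hc.comp (continuous_const.add continuous_angle)

/-- The cube is convenient for differentiating and the torus for translating; this identity allows
passing from one to the other. -/
lemma fproj_eq_integral_descend (k : Fin d → ℤ) {f : Phase d → E} (hf : PeriodicAng f)
    (x : Phase d) :
    fproj k f x = ∫ τ : UnitAddTorus (Fin d), mFourier (-k) τ • descend f x τ := by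
  rw [fproj]
  refine Eq.trans ?_ (integral_preimage (fun τ => mFourier (-k) τ • descend f x τ) 0).symm
  congr 1
  funext y
  rw [← descend_torusMk hf]
  rfl

lemma mFourier_add_apply (k : Fin d → ℤ) (σ τ : UnitAddTorus (Fin d)) :
    mFourier k (σ + τ) = mFourier k σ * mFourier k τ := by
  simp only [mFourier, ContinuousMap.coe_mk, ← Finset.prod_mul_distrib]
  refine Finset.prod_congr rfl fun i _ => ?_
  simp [fourier_apply, AddCircle.toCircle_add]

lemma mFourier_torusMk (k : Fin d → ℤ) (y : Fin d → ℝ) :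
    mFourier k (torusMk y) = Complex.exp (Complex.I * (dotInt k (angle y).2 : ℂ)) := by
  simp only [mFourier, ContinuousMap.coe_mk, torusMk, fourier_coe_apply, ← Complex.exp_sum]
  congr 1
  simp only [dotInt, angle, Complex.ofReal_sum, Finset.mul_sum]
  refine Finset.sum_congr rfl fun i _ => ?_
  push_cast
  ring

/-- Translation invariance of Haar measure on the torus, together with the character property of
`mFourier`. -/
lemma fproj_add_angle (k : Fin d → ℤ) {f : Phase d → E} (hf : PeriodicAng f)
    (x : Phase d) (s : Fin d → ℝ) :
    fproj k f (x + angle s) = mFourier k (torusMk s) • fproj k f x := by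
  rw [fproj_eq_integral_descend k hf, fproj_eq_integral_descend k hf]
  have h1 : ∀ τ, descend f (x + angle s) τ = descend f x (τ + torusMk s) := by
    intro τ
    obtain ⟨y, rfl⟩ : ∃ y, torusMk y = τ :=
      ⟨fun i => (AddCircle.equivIoc (1 : ℝ) 0 (τ i)).1,
        funext fun i => (AddCircle.equivIoc (1 : ℝ) 0).symm_apply_apply (τ i)⟩
    have : torusMk y + torusMk s = torusMk (y + s) := by
      funext i; simp [torusMk]
    rw [this, descend_torusMk hf, descend_torusMk hf, angle_add]
    congr 1
    abel
  have h2 := integral_add_right_eq_self (μ := (volume : Measure (UnitAddTorus (Fin d))))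
    (fun τ => mFourier (-k) (τ - torusMk s) • descend f x τ) (torusMk s)
  simp only [add_sub_cancel_right] at h2
  simp only [h1]
  refine h2.trans ?_
  rw [← integral_smul]
  congr 1
  funext τ
  rw [smul_smul, sub_eq_add_neg, mFourier_add_apply, mul_comm]
  congr 2
  simp only [mFourier, ContinuousMap.coe_mk]
  refine Finset.prod_congr rfl fun i _ => ?_
  simp [fourier_apply]

/-- The angle translation by `v`, in the form used by `fproj`. -/
lemma exists_angle_eq (v : Vec d) : ∃ s : Fin d → ℝ, angle s = (0, v) := by
  refine ⟨fun i => v i / (2 * Real.pi), ?_⟩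
  ext i
  · simp [angle]
  · simp only [angle]
    field_simp

lemma fproj_add (k : Fin d → ℤ) {f : Phase d → E} (hf : PeriodicAng f)
    (x : Phase d) (v : Vec d) :
    fproj k f (x + (0, v)) = Complex.exp (Complex.I * (dotInt k v : ℂ)) • fproj k f x := by
  obtain ⟨s, hs⟩ := exists_angle_eq v
  rw [← hs, fproj_add_angle k hf, mFourier_torusMk, hs]

/-- This replaces integration by parts: the covariance `fproj_add` is differentiated along the angle
direction `v`, and uniqueness of the derivative identifies the two expressions. -/
lemma fproj_fderiv_apply (k : Fin d → ℤ) {f : Phase d → E} (hp : PeriodicAng f)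
    (hf : ContDiff ℝ 1 f) {C : ℝ} (hC : ∀ x, ‖fderiv ℝ f x‖ ≤ C) (x : Phase d) (v : Vec d) :
    fproj k (fderiv ℝ f) x (0, v) = (Complex.I * (dotInt k v : ℂ)) • fproj k f x := by
  have h1 : HasDerivAt (fun t : ℝ => fproj k f (x + t • (0, v))) (fproj k (fderiv ℝ f) x (0, v)) 0 := by
    have := hasFDerivAt_fproj k hf hC x
    have h2 : HasDerivAt (fun t : ℝ => x + t • ((0 : Vec d), v)) (0, v) 0 := by
      simpa using ((hasDerivAt_id (0 : ℝ)).smul_const ((0 : Vec d), v)).const_add x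
    have h3 : HasFDerivAt (fproj k f) (fproj k (fderiv ℝ f) x)
        ((fun t : ℝ => x + t • ((0 : Vec d), v)) 0) := by simpa using this
    exact h3.comp_hasDerivAt (0 : ℝ) h2
  have h4 : (fun t : ℝ => fproj k f (x + t • (0, v))) =
      fun t : ℝ => Complex.exp (Complex.I * (dotInt k v : ℂ) * t) • fproj k f x := by
    funext t
    have : t • ((0 : Vec d), v) = (0, t • v) := by simp
    rw [this, fproj_add k hp]
    congr 2
    rw [← inner_intVec, ← inner_intVec, inner_smul_right]
    push_cast
    ring
  rw [h4] at h1
  have h5 : HasDerivAt (fun t : ℝ => Complex.exp (Complex.I * (dotInt k v : ℂ) * t))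
      (Complex.I * (dotInt k v : ℂ)) 0 := by
    have := ((hasDerivAt_id (0 : ℝ)).ofReal_comp.const_mul (Complex.I * (dotInt k v : ℂ))).cexp
    simpa using this
  exact h1.unique (h5.smul_const _)

end Fourier

end Nekhoroshev

end

noncomputable section

namespace Nekhoroshev

open scoped NNReal

open MeasureTheory UnitAddTorus

/-! ### Rapid decay of Fourier projections and convergence of the Fourier series. -/

section FourierDecay

set_option linter.unusedSectionVars false

variable {d : ℕ} {ι : Type} {E : Type} [NormedAddCommGroup E] [NormedSpace ℝ E] [NormedSpace ℂ E]
  [IsScalarTower ℝ ℂ E] [CompleteSpace E]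

lemma PeriodicAng.fderiv {F : Type} [NormedAddCommGroup F] [NormedSpace ℝ F]
    {f : Phase d → F} (hf : PeriodicAng f) :
    PeriodicAng (_root_.fderiv ℝ f) := by
  intro x k
  rw [← fderiv_comp_add_right]
  congr 1
  funext y
  exact hf y k

lemma PeriodicAng.comp {F G : Type} {f : Phase d → F} (hf : PeriodicAng f) (g : F → G) :
    PeriodicAng fun x => g (f x) := fun x k => by simp only [hf x k]

/-- Polynomial weights on the Fourier modes. -/
def weight (N : ℕ) (k : Fin d → ℤ) : ℝ≥0 := ((1 + ‖k‖₊) ^ N)⁻¹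

lemma weight_add (M N : ℕ) (k : Fin d → ℤ) : weight (M + N) k = weight M k * weight N k := by
  rw [weight, weight, weight, pow_add, mul_inv]

/-- Each derivative in the angle `q_j` multiplies the `k`-th projection by `i k_j`, so a power of
`|k j|` is paid for by one more derivative of `f`. -/
lemma pow_mul_norm_fproj_le (N : ℕ) (j : Fin d) : ∀ {f : ι → Phase d → E} {η : ι → ℝ≥0},
    UnifBdd f η → (∀ i, PeriodicAng (f i)) →
    ∃ C : ℝ≥0, ∀ i k x, |(k j : ℝ)| ^ N * ‖fproj k (f i) x‖ ≤ C * η i := by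
  induction N with
  | zero =>
    intro f η hf _
    obtain ⟨C, hC⟩ := hf.norm_le
    exact ⟨C, fun i k x => by simpa using norm_fproj_le k (hC i) x⟩
  | succ N ih =>
    intro f η hf hp
    let e : Vec d := EuclideanSpace.single j 1
    let L : (Phase d →L[ℝ] E) →L[ℝ] E := ContinuousLinearMap.apply ℝ E ((0, e) : Phase d)
    obtain ⟨C, hC⟩ := ih (hf.fderiv.clm L) fun i => (hp i).fderiv.comp L
    obtain ⟨D, hD⟩ := hf.norm_fderiv_le
    refine ⟨C, fun i k x => (le_of_eq ?_).trans (hC i k x)⟩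
    rw [fproj_clm L (fun c e => rfl) k (hf.fderiv.smooth i).continuous x]
    have h1 : L (fproj k (fderiv ℝ (f i)) x) = (Complex.I * (dotInt k e : ℂ)) • fproj k (f i) x :=
      fproj_fderiv_apply k (hp i) ((hf.smooth i).of_le (by simp)) (hD i) x e
    have h2 : dotInt k e = k j := by
      simp [dotInt, e]
    rw [h1, norm_smul, h2, pow_succ]
    simp
    ring

lemma exists_norm_eq (k : Fin d → ℤ) : ‖k‖ = 0 ∨ ∃ j, ‖k‖ = |(k j : ℝ)| := by
  rcases isEmpty_or_nonempty (Fin d) with h | h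
  · left; simp [Subsingleton.elim k 0]
  · right
    obtain ⟨j, -, hj⟩ := Finset.exists_mem_eq_sup Finset.univ Finset.univ_nonempty fun j => ‖k j‖₊
    refine ⟨j, ?_⟩
    rw [Pi.norm_def, hj]
    simp [Int.norm_eq_abs]

/-- The mode `k` is made part of the index, so that uniformity in `k` is the uniformity of
`BddDeriv`. The sup norm of `k` is attained at some coordinate, and `pow_mul_norm_fproj_le` is used
there. -/
lemma bddDeriv_zero_fproj {f : ι → Phase d → E} {η : ι → ℝ≥0} (hf : UnifBdd f η)
    (hp : ∀ i, PeriodicAng (f i)) (N : ℕ) :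
    BddDeriv 0 (fun p : ι × (Fin d → ℤ) => fproj p.2 (f p.1)) (fun p => weight N p.2 * η p.1) := by
  choose C hC using fun j => pow_mul_norm_fproj_le N j hf hp
  obtain ⟨C₀, hC₀⟩ := hf.norm_le
  refine ⟨2 ^ N * (C₀ + ∑ j, C j), fun p x => ?_⟩
  rw [norm_iteratedFDeriv_zero]
  obtain ⟨i, k⟩ := p
  simp only
  have h0 : ‖fproj k (f i) x‖ ≤ C₀ * η i := norm_fproj_le k (hC₀ i) x
  have hk : ‖k‖ ^ N * ‖fproj k (f i) x‖ ≤ (C₀ + ∑ j, C j) * η i := by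
    rcases exists_norm_eq k with h | ⟨j, h⟩
    · rw [h]
      calc (0 : ℝ) ^ N * ‖fproj k (f i) x‖ ≤ 1 * (C₀ * η i) :=
            mul_le_mul (pow_le_one₀ le_rfl zero_le_one) h0 (norm_nonneg _) zero_le_one
        _ ≤ _ := by
            rw [one_mul, add_mul]
            exact le_add_of_nonneg_right (by positivity)
    · rw [h]
      refine (hC j i k x).trans ?_
      gcongr
      refine le_trans ?_ (le_add_of_nonneg_left C₀.2)
      exact_mod_cast Finset.single_le_sum (f := C) (fun _ _ => zero_le) (Finset.mem_univ j)
  have h0' : ‖fproj k (f i) x‖ ≤ (C₀ + ∑ j, C j) * η i := by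
    refine h0.trans ?_
    rw [add_mul]
    exact le_add_of_nonneg_right (by positivity)
  have hmain : (1 + ‖k‖) ^ N * ‖fproj k (f i) x‖ ≤ 2 ^ N * ((C₀ + ∑ j, C j) * η i) := by
    rcases le_total ‖k‖ 1 with h | h
    · have : (1 + ‖k‖) ^ N ≤ 2 ^ N := by gcongr; linarith
      exact mul_le_mul this h0' (norm_nonneg _) (by positivity)
    · have : (1 + ‖k‖) ^ N ≤ 2 ^ N * ‖k‖ ^ N := by
        rw [← mul_pow]; gcongr; linarith
      calc _ ≤ 2 ^ N * ‖k‖ ^ N * ‖fproj k (f i) x‖ := by gcongr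
        _ ≤ _ := by rw [mul_assoc]; gcongr
  have hpos : 0 < (1 + ‖k‖) ^ N := by positivity
  rw [weight]
  push_cast
  calc ‖fproj k (f i) x‖ = ((1 + ‖k‖) ^ N)⁻¹ * ((1 + ‖k‖) ^ N * ‖fproj k (f i) x‖) := by
        field_simp
    _ ≤ ((1 + ‖k‖) ^ N)⁻¹ * (2 ^ N * ((C₀ + ∑ j, C j) * η i)) := by gcongr
    _ = _ := by push_cast; ring

lemma fderiv_fproj (k : Fin d → ℤ) {f : ι → Phase d → E} {η : ι → ℝ≥0} (hf : UnifBdd f η) (i : ι) :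
    fderiv ℝ (fproj k (f i)) = fproj k (fderiv ℝ (f i)) := by
  obtain ⟨D, hD⟩ := hf.norm_fderiv_le
  funext x
  exact (hasFDerivAt_fproj k ((hf.smooth i).of_le (by simp)) (hD i) x).fderiv

lemma contDiff_fproj (k : Fin d → ℤ) {f : ι → Phase d → E} {η : ι → ℝ≥0} (hf : UnifBdd f η)
    (i : ι) : ContDiff ℝ ∞ (fproj k (f i)) := by
  rw [contDiff_infty]
  intro n
  have hdiff : ∀ {E : Type} [NormedAddCommGroup E] [NormedSpace ℝ E] [NormedSpace ℂ E]
      [IsScalarTower ℝ ℂ E] [CompleteSpace E] {f : ι → Phase d → E}, UnifBdd f η →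
      Differentiable ℝ (fproj k (f i)) := by
    intro E _ _ _ _ _ f hf x
    obtain ⟨D, hD⟩ := hf.norm_fderiv_le
    exact (hasFDerivAt_fproj k ((hf.smooth i).of_le (by simp)) (hD i) x).differentiableAt
  induction n generalizing E with
  | zero => exact contDiff_zero.2 (hdiff hf).continuous
  | succ n ih =>
    push_cast
    rw [contDiff_succ_iff_fderiv]
    refine ⟨hdiff hf, by simp, ?_⟩
    rw [fderiv_fproj k hf]
    exact ih hf.fderiv

/-- The Fourier projections of a bounded family decay faster than any power of the frequency. -/
lemma UnifBdd.fproj {f : ι → Phase d → E} {η : ι → ℝ≥0} (hf : UnifBdd f η)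
    (hp : ∀ i, PeriodicAng (f i)) (N : ℕ) :
    UnifBdd (fun p : ι × (Fin d → ℤ) => Nekhoroshev.fproj p.2 (f p.1))
      (fun p => weight N p.2 * η p.1) where
  smooth p := contDiff_fproj p.2 hf p.1
  bdd n := by
    induction n generalizing E with
    | zero => exact bddDeriv_zero_fproj hf hp N
    | succ n ih =>
      rw [bddDeriv_succ_iff]
      have : (fun p : ι × (Fin d → ℤ) => _root_.fderiv ℝ (Nekhoroshev.fproj p.2 (f p.1))) =
          fun p => Nekhoroshev.fproj p.2 (_root_.fderiv ℝ (f p.1)) :=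
        funext fun p => fderiv_fproj p.2 hf p.1
      rw [this]
      exact ih (f := fun i => _root_.fderiv ℝ (f i)) hf.fderiv fun i => (hp i).fderiv

lemma summable_inv_one_add_abs_sq : Summable fun n : ℤ => ((1 + |(n : ℝ)|) ^ 2)⁻¹ := by
  apply Summable.of_nonneg_of_le (fun n => by positivity) (f := fun n : ℤ => 1 / (n : ℝ) ^ 2 +
    (if n = 0 then 1 else 0))
  · intro n
    by_cases h : n = 0
    · simp [h]
    · have hn : 0 < |(n : ℝ)| := by simpa using h
      simp only [h, if_false, add_zero, one_div]
      rw [← sq_abs (n : ℝ)]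
      gcongr
      linarith
  · exact (Real.summable_one_div_int_pow.2 one_lt_two).add
      (summable_of_ne_finset_zero (s := {0}) fun n hn => by simpa using hn)

/-- The exponent `2 * d` spends a factor `(1 + |k i|) ^ (-2)` on each coordinate; finite sums are
then enlarged to boxes, where they factor. -/
lemma summable_weight : Summable fun k : Fin d → ℤ => (weight (2 * d) k : ℝ) := by
  classical
  let g : ℤ → ℝ := fun n => ((1 + |(n : ℝ)|) ^ 2)⁻¹
  have hg : ∀ n, 0 ≤ g n := fun n => by positivity
  apply summable_of_sum_le (c := (∑' n, g n) ^ d) fun k => by positivity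
  intro s
  have h1 : ∀ k : Fin d → ℤ, (weight (2 * d) k : ℝ) ≤ ∏ i, g (k i) := by
    intro k
    simp only [weight, g]
    rw [Finset.prod_inv_distrib, pow_mul]
    push_cast
    apply inv_anti₀ (Finset.prod_pos fun i _ => by positivity)
    have : ((1 + ‖k‖) ^ 2) ^ d = ∏ _i : Fin d, (1 + ‖k‖) ^ 2 := by simp
    rw [this]
    gcongr with i
    simpa [Int.norm_eq_abs] using norm_le_pi_norm k i
  calc ∑ k ∈ s, (weight (2 * d) k : ℝ) ≤ ∑ k ∈ s, ∏ i, g (k i) := Finset.sum_le_sum fun k _ => h1 k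
    _ ≤ ∑ k ∈ Fintype.piFinset fun i => s.image fun k => k i, ∏ i, g (k i) := by
        apply Finset.sum_le_sum_of_subset_of_nonneg
        · intro k hk
          rw [Fintype.mem_piFinset]
          exact fun i => Finset.mem_image_of_mem _ hk
        · exact fun k _ _ => Finset.prod_nonneg fun i _ => hg _
    _ = ∏ i : Fin d, ∑ n ∈ s.image (fun k => k i), g n := (Finset.prod_univ_sum _ _).symm
    _ ≤ ∏ _i : Fin d, ∑' n, g n := by
        apply Finset.prod_le_prod
        · exact fun i _ => Finset.sum_nonneg fun n _ => hg n
        · exact fun i _ => summable_inv_one_add_abs_sq.sum_le_tsum _ fun n _ => hg n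
    _ = _ := by simp

lemma summable_fproj {f : ι → Phase d → E} {η : ι → ℝ≥0} (hf : UnifBdd f η)
    (hp : ∀ i, PeriodicAng (f i)) (i : ι) (x : Phase d) : Summable fun k => fproj k (f i) x := by
  obtain ⟨C, hC⟩ := (hf.fproj hp (2 * d)).norm_le
  apply Summable.of_norm_bounded (g := fun k => C * (weight (2 * d) k * η i))
  · exact (summable_weight.mul_right _).mul_left _
  · exact fun k => by simpa using hC (i, k) x

/-- Absolutely summable Fourier coefficients of a continuous function on the torus sum to it
pointwise; the series based at `x` is evaluated at angle `0`. -/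
lemma hasSum_fproj_complex {f : ι → Phase d → ℂ} {η : ι → ℝ≥0} (hf : UnifBdd f η)
    (hp : ∀ i, PeriodicAng (f i)) (i : ι) (x : Phase d) :
    HasSum (fun k => fproj k (f i) x) (f i x) := by
  let F : C(UnitAddTorus (Fin d), ℂ) :=
    ⟨descend (f i) x, continuous_descend (hp i) (hf.smooth i).continuous x⟩
  have hF : ∀ k, fproj k (f i) x = mFourierCoeff F k := fun k =>
    fproj_eq_integral_descend k (hp i) x
  have hs : Summable (mFourierCoeff F) := by
    have := summable_fproj hf hp i x
    simp only [hF] at this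
    exact this
  have := hasSum_mFourier_series_apply_of_summable hs (torusMk 0)
  simp only [hF]
  have h1 : F (torusMk 0) = f i x := by
    change descend (f i) x (torusMk 0) = f i x
    rw [descend_torusMk (hp i)]
    congr 1
    ext j <;> simp [angle]
  rw [h1] at this
  convert this using 1
  funext k
  rw [mFourier_torusMk]
  simp [dotInt, angle]

/-- A smooth function is the sum of its Fourier projections. -/
lemma hasSum_fproj {f : ι → Phase d → E} {η : ι → ℝ≥0} (hf : UnifBdd f η)
    (hp : ∀ i, PeriodicAng (f i)) (i : ι) (x : Phase d) :
    HasSum (fun k => fproj k (f i) x) (f i x) := by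
  have hs := summable_fproj hf hp i x
  have h := hs.hasSum
  have heq : ∑' k, fproj k (f i) x = f i x := by
    rw [← sub_eq_zero]
    -- Complex functionals separate points and commute with `fproj`, which reduces the claim to
    -- scalar functions.
    apply SeparatingDual.eq_zero_of_forall_dual_eq_zero (R := ℂ)
    intro φ
    let L : E →L[ℝ] ℂ := φ.restrictScalars ℝ
    have h1 := hasSum_fproj_complex (hf.clm L) (fun i => (hp i).comp L) i x
    have h2 := h.mapL L
    have h3 : (fun k => fproj k (fun x => L (f i x)) x) = fun k => L (fproj k (f i) x) :=
      funext fun k => fproj_clm L (fun c e => φ.map_smul c e) k (hf.smooth i).continuous x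
    rw [h3] at h1
    have h4 := h2.unique h1
    change L _ = 0
    rw [map_sub, sub_eq_zero]
    exact h4
  rwa [heq] at h

end FourierDecay

end Nekhoroshev

end

noncomputable section

namespace Nekhoroshev

open scoped NNReal

/-! ### Fourier truncation and multipliers with symbols in `k · p`. -/

section Multipliers

variable {d : ℕ} {ι : Type}

/-- Sums over finite sets of modes of families with summable bounds. -/
lemma UnifBdd.sum_modes {F : Type} [NormedAddCommGroup F] [NormedSpace ℝ F]
    {g : ι × (Fin d → ℤ) → Phase d → F} {η : ι → ℝ≥0}
    (hg : UnifBdd g fun p => weight (2 * d) p.2 * η p.1) (s : ι → Finset (Fin d → ℤ)) :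
    UnifBdd (fun i x => ∑ k ∈ s i, g (i, k) x) η where
  smooth i := ContDiff.sum fun k _ => hg.smooth (i, k)
  bdd n := by
    obtain ⟨C, hC⟩ := hg.bdd n
    have hsum : Summable fun k : Fin d → ℤ => weight (2 * d) k :=
      NNReal.summable_coe.1 summable_weight
    refine ⟨C * ∑' k : Fin d → ℤ, weight (2 * d) k, fun i x => ?_⟩
    have h1 : iteratedFDeriv ℝ n (fun x => ∑ k ∈ s i, g (i, k) x) x =
        ∑ k ∈ s i, iteratedFDeriv ℝ n (g (i, k)) x :=
      iteratedFDeriv_fun_sum_apply fun k _ =>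
        (hg.smooth (i, k)).contDiffAt.of_le (by exact_mod_cast le_top)
    rw [h1]
    calc ‖∑ k ∈ s i, iteratedFDeriv ℝ n (g (i, k)) x‖
        ≤ ∑ k ∈ s i, (C : ℝ) * ((weight (2 * d) k * η i : ℝ≥0) : ℝ) :=
          (norm_sum_le _ _).trans (Finset.sum_le_sum fun k _ => hC (i, k) x)
      _ = C * ((∑ k ∈ s i, weight (2 * d) k : ℝ≥0) : ℝ) * η i := by
          push_cast
          rw [Finset.mul_sum, Finset.sum_mul]
          exact Finset.sum_congr rfl fun k _ => by ring
      _ ≤ _ := by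
          push_cast
          gcongr
          exact_mod_cast hsum.sum_le_tsum _ fun _ _ => zero_le

/-- The part of `f` made of the Fourier modes outside `s`. -/
def tail {E : Type} [NormedAddCommGroup E] [NormedSpace ℝ E] [NormedSpace ℂ E]
    (s : Finset (Fin d → ℤ)) (f : Phase d → E) (x : Phase d) : E :=
  f x - ∑ k ∈ s, fproj k f x

lemma norm_intVec_le_mul (k : Fin d → ℤ) : ‖intVec k‖ ≤ d * ‖k‖ := by
  rw [EuclideanSpace.norm_eq]
  apply Real.sqrt_le_iff.2 ⟨by positivity, ?_⟩
  calc ∑ i, ‖intVec k i‖ ^ 2 ≤ ∑ _i : Fin d, ‖k‖ ^ 2 := by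
        gcongr with i
        simpa [intVec, Int.norm_eq_abs] using norm_le_pi_norm k i
    _ = d * ‖k‖ ^ 2 := by simp
    _ ≤ d ^ 2 * ‖k‖ ^ 2 := by
        gcongr
        exact_mod_cast Nat.le_self_pow two_ne_zero d
    _ = _ := by ring

lemma one_add_le_of_notMem_modes {K : ℕ} {k : Fin d → ℤ} (hk : k ∉ modes d K) :
    (1 + K : ℝ) ≤ (d + 1) * (1 + ‖k‖) := by
  rw [mem_modes_iff, not_le] at hk
  have h1 := norm_intVec_le_mul k
  nlinarith [norm_nonneg k]

lemma norm_sub_sum_le_of_hasSum {κ E : Type} [NormedAddCommGroup E] {u : κ → E} {e : E}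
    (hu : HasSum u e) (s : Finset κ) {w : κ → ℝ≥0} (hw : Summable w) {A : ℝ≥0}
    (h : ∀ k, k ∉ s → ‖u k‖ ≤ A * w k) : ‖e - ∑ k ∈ s, u k‖ ≤ A * (∑' k, w k : ℝ≥0) := by
  have h1 := (s.hasSum_iff_compl).1 hu
  rw [← h1.tsum_eq, NNReal.coe_tsum, ← tsum_mul_left]
  have hw' : Summable fun k => (A : ℝ) * (w k : ℝ) := (NNReal.summable_coe.2 hw).mul_left _
  have hsub : Summable fun k : {k // k ∉ s} => (A : ℝ) * (w k.1 : ℝ) :=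
    hw'.comp_injective Subtype.val_injective
  refine (tsum_of_norm_bounded hsub.hasSum fun k => h k.1 k.2).trans ?_
  exact hsub.tsum_le_tsum_of_inj Subtype.val Subtype.val_injective (fun _ _ => by positivity)
    (fun _ => le_rfl) hw'

/-- Decay of order `N + 2 * d` is split: outside `modes` the first `N` powers give the factor in
`K`, and the remaining `2 * d` keep the sum over `k` finite. -/
lemma bddDeriv_zero_tail {E : Type} [NormedAddCommGroup E] [NormedSpace ℝ E] [NormedSpace ℂ E]
    [IsScalarTower ℝ ℂ E] [CompleteSpace E] {f : ι → Phase d → E} {η : ι → ℝ≥0}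
    (hf : UnifBdd f η) (hp : ∀ i, PeriodicAng (f i)) (K : ι → ℕ) (N : ℕ) :
    BddDeriv 0 (fun i => tail (modes d (K i)) (f i))
      (fun i => ((1 + (K i : ℝ≥0)) ^ N)⁻¹ * η i) := by
  obtain ⟨C, hC⟩ := (hf.fproj hp (N + 2 * d)).norm_le
  have hsum : Summable fun k : Fin d → ℤ => weight (2 * d) k :=
    NNReal.summable_coe.1 summable_weight
  refine ⟨(d + 1) ^ N * C * ∑' k : Fin d → ℤ, weight (2 * d) k, fun i x => ?_⟩
  simp only [norm_iteratedFDeriv_zero, tail]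
  have hterm : ∀ k, k ∉ modes d (K i) → ‖fproj k (f i) x‖ ≤
      ((d + 1) ^ N * C * (((1 + (K i : ℝ≥0)) ^ N)⁻¹ * η i) : ℝ≥0) * weight (2 * d) k := by
    intro k hk
    have h2 := hC (i, k) x
    refine h2.trans ?_
    simp only [weight_add]
    have h3 : weight N k ≤ (d + 1) ^ N * ((1 + (K i : ℝ≥0)) ^ N)⁻¹ := by
      rw [weight, ← div_eq_mul_inv, le_div_iff₀ (by positivity), ← div_eq_inv_mul,
        div_le_iff₀ (by positivity), ← mul_pow]
      gcongr
      have := one_add_le_of_notMem_modes hk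
      rw [← NNReal.coe_le_coe]
      push_cast
      exact this
    rw [← NNReal.coe_mul, ← NNReal.coe_mul, NNReal.coe_le_coe]
    calc C * (weight N k * weight (2 * d) k * η i)
        ≤ C * ((d + 1) ^ N * ((1 + (K i : ℝ≥0)) ^ N)⁻¹ * weight (2 * d) k * η i) := by gcongr
      _ = _ := by ring
  refine (norm_sub_sum_le_of_hasSum (hasSum_fproj hf hp i x) _ hsum hterm).trans (le_of_eq ?_)
  push_cast
  ring

/-- Truncation commutes with differentiation, so all orders follow from order zero applied to
derivatives. -/
lemma UnifBdd.tail {E : Type} [NormedAddCommGroup E] [NormedSpace ℝ E] [NormedSpace ℂ E]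
    [IsScalarTower ℝ ℂ E] [CompleteSpace E] {f : ι → Phase d → E} {η : ι → ℝ≥0}
    (hf : UnifBdd f η) (hp : ∀ i, PeriodicAng (f i)) (K : ι → ℕ) (N : ℕ) :
    UnifBdd (fun i => Nekhoroshev.tail (modes d (K i)) (f i))
      (fun i => ((1 + (K i : ℝ≥0)) ^ N)⁻¹ * η i) where
  smooth i := (hf.smooth i).sub (ContDiff.sum fun k _ => contDiff_fproj k hf i)
  bdd n := by
    induction n generalizing E with
    | zero => exact bddDeriv_zero_tail hf hp K N
    | succ n ih =>
      rw [bddDeriv_succ_iff]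
      have : (fun i => _root_.fderiv ℝ (Nekhoroshev.tail (modes d (K i)) (f i))) =
          fun i => Nekhoroshev.tail (modes d (K i)) (_root_.fderiv ℝ (f i)) := by
        funext i x
        unfold Nekhoroshev.tail
        rw [fderiv_fun_sub ((hf.smooth i).differentiable (by simp) x)
          (DifferentiableAt.fun_sum fun k _ => (contDiff_fproj k hf i).differentiable (by simp) x),
          fderiv_fun_sum fun k _ => (contDiff_fproj k hf i).differentiable (by simp) x]
        congr 1
        refine Finset.sum_congr rfl fun k _ => ?_
        rw [fderiv_fproj k hf]
      rw [this]
      exact ih (f := fun i => _root_.fderiv ℝ (f i)) hf.fderiv fun i => (hp i).fderiv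

/-- The linear form `(p, q) ↦ k · p`. -/
def dotL (k : Fin d → ℤ) : Phase d →L[ℝ] ℝ :=
  (innerSL ℝ (intVec k)).comp (ContinuousLinearMap.fst ℝ (Vec d) (Vec d))

lemma dotL_apply (k : Fin d → ℤ) (x : Phase d) : dotL k x = dotInt k x.1 := by
  simp [dotL, inner_intVec]

lemma norm_dotL_le (k : Fin d → ℤ) : ‖dotL k‖ ≤ d * ‖k‖ := by
  have h1 := norm_intVec_le_mul k
  refine (ContinuousLinearMap.opNorm_comp_le _ _).trans ?_
  rw [innerSL_apply_norm]
  calc ‖intVec k‖ * ‖ContinuousLinearMap.fst ℝ (Vec d) (Vec d)‖ ≤ ‖intVec k‖ * 1 := by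
        gcongr; exact ContinuousLinearMap.norm_fst_le _ _ _
    _ ≤ _ := by rw [mul_one]; exact h1

/-- The Fourier multiplier with symbol `a (k · p)`, restricted to the modes in `s`. -/
def multiplier (a : ℝ → ℂ) (s : Finset (Fin d → ℤ)) (f : Phase d → ℂ) (x : Phase d) : ℂ :=
  ∑ k ∈ s, a (dotL k x) * fproj k f x

/-- The `m`-th derivative of `a (k · p)` costs `|k| ^ m`. At order `n` the decay of `fproj` is used
with exponent `n + 2 * d`, so the loss is absorbed and the bound depends neither on `s` nor on the
number of modes. -/
lemma UnifBdd.multiplier {a : ℝ → ℂ} (ha : UnifBdd (fun _ : Unit => a) 1)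
    {f : ι → Phase d → ℂ} {η : ι → ℝ≥0} (hf : UnifBdd f η) (hp : ∀ i, PeriodicAng (f i))
    (s : ι → Finset (Fin d → ℤ)) :
    UnifBdd (fun i => Nekhoroshev.multiplier a (s i) (f i)) η := by
  have has : ∀ p : ι × (Fin d → ℤ), ContDiff ℝ ∞ fun x => a (dotL p.2 x) := fun p =>
    (ha.smooth ()).comp (dotL p.2).contDiff
  have hab : ∀ m, BddDeriv m (fun (p : ι × (Fin d → ℤ)) x => a (dotL p.2 x))
      (fun p => (1 + ‖p.2‖₊) ^ m) := by
    intro m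
    obtain ⟨C, hC⟩ := ha.bdd m
    refine ⟨C * d ^ m, fun p x => ?_⟩
    have h1 : iteratedFDeriv ℝ m (fun x => a (dotL p.2 x)) x = _ :=
      (dotL p.2).iteratedFDeriv_comp_right (ha.smooth ()) x (i := m) (by exact_mod_cast le_top)
    rw [h1]
    refine (ContinuousMultilinearMap.norm_compContinuousLinearMap_le _ _).trans ?_
    have h2 := hC () (dotL p.2 x)
    simp only [Pi.one_apply, NNReal.coe_one, mul_one] at h2
    have h3 : ‖dotL p.2‖ ≤ d * (1 + ‖p.2‖) :=
      (norm_dotL_le p.2).trans (by gcongr; linarith)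
    rw [Finset.prod_const, Finset.card_univ, Fintype.card_fin]
    calc _ ≤ (C : ℝ) * (d * (1 + ‖p.2‖)) ^ m := by gcongr
      _ = _ := by push_cast; rw [mul_pow]; ring
  have hprod : UnifBdd (fun (p : ι × (Fin d → ℤ)) x => a (dotL p.2 x) * Nekhoroshev.fproj p.2 (f p.1) x)
      (fun p => weight (2 * d) p.2 * η p.1) := by
    refine ⟨fun p => (has p).mul (contDiff_fproj p.2 hf p.1), fun n => ?_⟩
    have h1 : ∀ m ≤ n, BddDeriv m (fun (p : ι × (Fin d → ℤ)) x => a (dotL p.2 x))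
        (fun p => (1 + ‖p.2‖₊) ^ n) := by
      intro m hm
      obtain ⟨C, hC⟩ := hab m
      refine ⟨C, fun p x => (hC p x).trans ?_⟩
      have : (1 + ‖p.2‖₊) ^ m ≤ (1 + ‖p.2‖₊) ^ n := pow_le_pow_right₀ (by simp) hm
      gcongr
    have h2 := BddDeriv.bilin (ContinuousLinearMap.mul ℝ ℂ) has
      (fun p => contDiff_fproj p.2 hf p.1) h1 (fun m (_ : m ≤ n) => (hf.fproj hp (n + 2 * d)).bdd m)
    have h3 : (fun p : ι × (Fin d → ℤ) => weight (2 * d) p.2 * η p.1) =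
        (fun p => (1 + ‖p.2‖₊) ^ n) * fun p => weight (n + 2 * d) p.2 * η p.1 := by
      funext p
      change _ = (1 + ‖p.2‖₊) ^ n * (weight (n + 2 * d) p.2 * η p.1)
      rw [weight_add, weight, weight]
      field_simp
    rw [h3]
    exact h2
  exact hprod.sum_modes s

/-- The symbols depend on the actions only, so a derivative in the angles falls entirely on the
projections. -/
lemma fderiv_multiplier_apply (a : ℝ → ℂ) (ha : ContDiff ℝ ∞ a) {f : ι → Phase d → ℂ}
    {η : ι → ℝ≥0} (hf : UnifBdd f η) (hp : ∀ i, PeriodicAng (f i)) (i : ι)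
    (s : Finset (Fin d → ℤ)) (x : Phase d) (v : Vec d) :
    fderiv ℝ (multiplier a s (f i)) x (0, v) =
      ∑ k ∈ s, a (dotL k x) * ((Complex.I * (dotInt k v : ℂ)) * fproj k (f i) x) := by
  obtain ⟨D, hD⟩ := hf.norm_fderiv_le
  have h1 : ∀ k, HasFDerivAt (fun x => a (dotL k x)) ((fderiv ℝ a (dotL k x)).comp (dotL k)) x :=
    fun k => (ha.differentiable (by simp) _).hasFDerivAt.comp x (dotL k).hasFDerivAt
  have h2 : ∀ k, HasFDerivAt (fproj k (f i)) (fproj k (fderiv ℝ (f i)) x) x := fun k =>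
    hasFDerivAt_fproj k ((hf.smooth i).of_le (by simp)) (hD i) x
  have h3 : HasFDerivAt (multiplier a s (f i)) _ x :=
    HasFDerivAt.fun_sum fun k _ => (h1 k).mul (h2 k)
  rw [h3.fderiv]
  rw [_root_.sum_apply]
  refine Finset.sum_congr rfl fun k _ => ?_
  have h4 := fproj_fderiv_apply k (hp i) ((hf.smooth i).of_le (by simp)) (hD i) x v
  have h5 : dotL k ((0 : Vec d), v) = 0 := by rw [dotL_apply]; simp [dotInt]
  simp [h4, h5]

end Multipliers

end Nekhoroshev

end

noncomputable section

namespace Nekhoroshev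

open scoped NNReal

/-! ### The homological equation -/

section Symbols

/-- A smooth cutoff, equal to `1` near `0` and supported in `[-1, 1]`. -/
def bump : ContDiffBump (0 : ℝ) := ⟨1 / 2, 1, by norm_num, by norm_num⟩

lemma bump_eq_zero {x : ℝ} (hx : 1 ≤ |x|) : bump x = 0 :=
  bump.zero_of_le_dist (by simpa [bump] using hx)

lemma bump_zero : bump 0 = 1 := bump.one_of_mem_closedBall (by simp [bump])

/-- The regularized inverse `(1 - bump x) / x`. -/
def regInv (x : ℝ) : ℝ := (1 - bump x) * x⁻¹

lemma regInv_mul (x : ℝ) : regInv x * x = 1 - bump x := by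
  rcases eq_or_ne x 0 with rfl | h
  · simp [bump_zero]
  · rw [regInv, mul_assoc, inv_mul_cancel₀ h, mul_one]

lemma contDiff_regInv : ContDiff ℝ ∞ regInv := by
  rw [contDiff_iff_contDiffAt]
  intro x
  rcases eq_or_ne x 0 with rfl | h
  · have : regInv =ᶠ[nhds 0] fun _ => 0 := by
      filter_upwards [bump.eventuallyEq_one] with y hy
      simp [regInv, hy]
    exact contDiffAt_const.congr_of_eventuallyEq this
  · exact (contDiffAt_const.sub bump.contDiffAt).mul (contDiffAt_inv ℝ h)

/-- Compactness takes care of `[-1, 1]`. Outside it the symbols are explicit: `bump` vanishes and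
`regInv` is the inverse. -/
lemma unifBdd_of_real {F : Type} [NormedAddCommGroup F] [NormedSpace ℝ F] {f : ℝ → F}
    (hf : ContDiff ℝ ∞ f)
    (h : ∀ n, ∃ C : ℝ, ∀ x, 1 < |x| → ‖iteratedFDeriv ℝ n f x‖ ≤ C) :
    UnifBdd (fun _ : Unit => f) 1 where
  smooth _ := hf
  bdd n := by
    obtain ⟨C, hC⟩ := h n
    obtain ⟨D, hD⟩ := (isCompact_Icc (a := (-1 : ℝ)) (b := 1)).exists_bound_of_continuousOn
      (hf.continuous_iteratedFDeriv (m := n) (by exact_mod_cast le_top)).continuousOn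
    refine ⟨Real.toNNReal (max C D), fun _ x => ?_⟩
    simp only [Pi.one_apply, NNReal.coe_one, mul_one, Real.coe_toNNReal']
    refine le_trans ?_ (le_max_left _ _)
    rcases le_or_gt |x| 1 with hx | hx
    · exact (hD x (abs_le.1 hx)).trans (le_max_right _ _)
    · exact (hC x hx).trans (le_max_left _ _)

lemma eventually_one_lt_abs {x : ℝ} (hx : 1 < |x|) : ∀ᶠ y in nhds x, 1 < |y| :=
  continuous_abs.continuousAt.eventually (lt_mem_nhds hx)

lemma unifBdd_bump : UnifBdd (fun _ : Unit => fun x : ℝ => bump x) 1 := by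
  apply unifBdd_of_real bump.contDiff
  intro n
  refine ⟨0, fun x hx => ?_⟩
  have h : (fun x => bump x) =ᶠ[nhds x] fun _ => (0 : ℝ) := by
    filter_upwards [eventually_one_lt_abs hx] with y hy
    exact bump_eq_zero hy.le
  rw [(h.iteratedFDeriv ℝ n).eq_of_nhds]
  simp

lemma unifBdd_regInv : UnifBdd (fun _ : Unit => regInv) 1 := by
  apply unifBdd_of_real contDiff_regInv
  intro n
  refine ⟨n.factorial, fun x hx => ?_⟩
  have h : regInv =ᶠ[nhds x] fun y => y⁻¹ := by
    filter_upwards [eventually_one_lt_abs hx] with y hy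
    simp [regInv, bump_eq_zero hy.le]
  rw [(h.iteratedFDeriv ℝ n).eq_of_nhds, norm_iteratedFDeriv_eq_norm_iteratedDeriv,
    iteratedDeriv_eq_iterate, iter_deriv_inv]
  simp only [norm_mul, norm_pow, norm_neg, norm_one, one_pow, one_mul, norm_zpow,
    Real.norm_eq_abs, Nat.abs_cast]
  apply mul_le_of_le_one_right (by positivity)
  apply zpow_le_one_of_nonpos₀ hx.le
  omega

/-- The symbol of the solution operator of the homological equation. -/
def solSymbol (x : ℝ) : ℂ := Complex.I * (regInv x : ℂ)

/-- The symbol of the projection on the resonant modes. -/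
def resSymbol (x : ℝ) : ℂ := (bump x : ℂ)

lemma unifBdd_resSymbol : UnifBdd (fun _ : Unit => resSymbol) 1 :=
  unifBdd_bump.clm Complex.ofRealCLM

lemma unifBdd_solSymbol : UnifBdd (fun _ : Unit => solSymbol) 1 :=
  unifBdd_regInv.clm (Complex.I • Complex.ofRealCLM)

end Symbols

section Homological

variable {d : ℕ} {ι : Type}

/-- Complexification of a real function. -/
def cplx (f : Phase d → ℝ) (x : Phase d) : ℂ := (f x : ℂ)

/-- The resonant part of `f`. -/
def resPart (K : ℕ) (f : Phase d → ℝ) (x : Phase d) : ℝ :=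
  (multiplier resSymbol (modes d K) (cplx f) x).re

/-- The solution `S` of the homological equation `p · ∂_q S + f = resPart f` up to the tail. -/
def homSol (K : ℕ) (f : Phase d → ℝ) (x : Phase d) : ℝ :=
  (multiplier solSymbol (modes d K) (cplx f) x).re

variable {f : ι → Phase d → ℝ} {η : ι → ℝ≥0}

lemma UnifBdd.cplx (hf : UnifBdd f η) : UnifBdd (fun i => Nekhoroshev.cplx (f i)) η :=
  hf.clm Complex.ofRealCLM

lemma PeriodicAng.cplx {f : Phase d → ℝ} (hf : PeriodicAng f) : PeriodicAng (Nekhoroshev.cplx f) :=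
  hf.comp _

lemma UnifBdd.resPart (hf : UnifBdd f η) (hp : ∀ i, PeriodicAng (f i)) (K : ι → ℕ) :
    UnifBdd (fun i => Nekhoroshev.resPart (K i) (f i)) η :=
  (UnifBdd.multiplier unifBdd_resSymbol hf.cplx (fun i => (hp i).cplx)
    fun i => modes d (K i)).clm Complex.reCLM

lemma UnifBdd.homSol (hf : UnifBdd f η) (hp : ∀ i, PeriodicAng (f i)) (K : ι → ℕ) :
    UnifBdd (fun i => Nekhoroshev.homSol (K i) (f i)) η :=
  (UnifBdd.multiplier unifBdd_solSymbol hf.cplx (fun i => (hp i).cplx)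
    fun i => modes d (K i)).clm Complex.reCLM

lemma PeriodicAng.multiplier {f : Phase d → ℂ} (hf : PeriodicAng f) (a : ℝ → ℂ)
    (s : Finset (Fin d → ℤ)) : PeriodicAng (Nekhoroshev.multiplier a s f) := by
  intro x k
  unfold Nekhoroshev.multiplier
  refine Finset.sum_congr rfl fun l _ => ?_
  congr 1
  · rw [dotL_apply, dotL_apply]; simp
  · unfold fproj
    congr 1
    funext y
    rw [add_right_comm, hf]

lemma PeriodicAng.resPart {f : Phase d → ℝ} (hf : PeriodicAng f) (K : ℕ) :
    PeriodicAng (Nekhoroshev.resPart K f) := (hf.cplx.multiplier _ _).comp _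

lemma PeriodicAng.homSol {f : Phase d → ℝ} (hf : PeriodicAng f) (K : ℕ) :
    PeriodicAng (Nekhoroshev.homSol K f) := (hf.cplx.multiplier _ _).comp _

lemma multiplier_sub (a : ℝ → ℂ) (s : Finset (Fin d → ℤ)) {f g : Phase d → ℂ} (hf : Continuous f)
    (hg : Continuous g) (x : Phase d) :
    multiplier a s (fun x => f x - g x) x = multiplier a s f x - multiplier a s g x := by
  unfold multiplier
  rw [← Finset.sum_sub_distrib]
  refine Finset.sum_congr rfl fun k _ => ?_
  rw [← mul_sub]
  congr 1
  unfold fproj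
  rw [← MeasureTheory.integral_sub (integrableOn_fproj_integrand k hf x)
    (integrableOn_fproj_integrand k hg x)]
  simp only [smul_sub]

lemma cplx_sub (f g : Phase d → ℝ) :
    cplx (fun x => f x - g x) = fun x => cplx f x - cplx g x := by
  funext x
  simp [cplx]

lemma resPart_sub (K : ℕ) {f g : Phase d → ℝ} (hf : Continuous f) (hg : Continuous g)
    (x : Phase d) : resPart K (fun x => f x - g x) x = resPart K f x - resPart K g x := by
  unfold resPart
  rw [cplx_sub, multiplier_sub _ _ (f := cplx f) (g := cplx g)
    (Complex.continuous_ofReal.comp hf) (Complex.continuous_ofReal.comp hg), Complex.sub_re]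

lemma homSol_sub (K : ℕ) {f g : Phase d → ℝ} (hf : Continuous f) (hg : Continuous g)
    (x : Phase d) : homSol K (fun x => f x - g x) x = homSol K f x - homSol K g x := by
  unfold homSol
  rw [cplx_sub, multiplier_sub _ _ (f := cplx f) (g := cplx g)
    (Complex.continuous_ofReal.comp hf) (Complex.continuous_ofReal.comp hg), Complex.sub_re]

/-- The homological equation. -/
lemma fderiv_homSol_add (hf : UnifBdd f η) (hp : ∀ i, PeriodicAng (f i)) (i : ι) (K : ℕ)
    (x : Phase d) :
    fderiv ℝ (homSol K (f i)) x (0, x.1) + f i x - resPart K (f i) x =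
      (tail (modes d K) (cplx (f i)) x).re := by
  have hs := (UnifBdd.multiplier unifBdd_solSymbol hf.cplx (fun i => (hp i).cplx)
    fun _ => modes d K).smooth i
  have h1 : fderiv ℝ (homSol K (f i)) x (0, x.1) =
      (fderiv ℝ (multiplier solSymbol (modes d K) (cplx (f i))) x (0, x.1)).re := by
    have := (Complex.reCLM.hasFDerivAt (x := multiplier solSymbol (modes d K) (cplx (f i)) x)).comp x
      (hs.differentiable (by simp) x).hasFDerivAt
    have h2 : HasFDerivAt (homSol K (f i)) _ x := this
    rw [h2.fderiv]
    rfl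
  rw [h1, fderiv_multiplier_apply solSymbol (unifBdd_solSymbol.smooth ()) hf.cplx
    (fun i => (hp i).cplx) i]
  have h3 : f i x = (cplx (f i) x).re := rfl
  rw [h3, resPart, ← Complex.add_re, ← Complex.sub_re]
  congr 1
  rw [tail, multiplier, add_comm, add_sub_assoc, ← Finset.sum_sub_distrib, sub_eq_add_neg,
    ← Finset.sum_neg_distrib]
  congr 1
  refine Finset.sum_congr rfl fun k _ => ?_
  -- Along `p` the derivative of mode `k` brings `i (k · p)`. With the factor `i` in `solSymbol`
  -- this gives `-(1 - bump)`, which cancels the nonresonant part of `f` and leaves `bump`.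
  have h4 : (regInv (dotL k x) : ℂ) * (dotInt k x.1 : ℂ) = 1 - bump (dotL k x) := by
    rw [← dotL_apply]
    exact_mod_cast regInv_mul (dotL k x)
  rw [solSymbol, resSymbol]
  linear_combination (Complex.I * Complex.I * fproj k (cplx (f i)) x) * h4 +
    (1 - (bump (dotL k x) : ℂ)) * fproj k (cplx (f i)) x * Complex.I_mul_I

lemma neg_mem_modes {K : ℕ} {k : Fin d → ℤ} (hk : k ∈ modes d K) : -k ∈ modes d K := by
  rw [mem_modes_iff] at hk ⊢
  have : intVec (-k) = -intVec k := by ext i; simp [intVec]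
  rwa [this, norm_neg]

/-- The resonant part is a trigonometric polynomial with resonant coefficients. -/
lemma exists_resPart_coeff {f : Phase d → ℝ} (hp : PeriodicAng f) (K : ℕ) :
    ∃ c : (Fin d → ℤ) → Vec d → ℂ,
      (∀ p q : Vec d, (resPart K f (p, q) : ℂ) =
        ∑ k ∈ modes d K, c k p * Complex.exp (Complex.I * (dotInt k q : ℂ))) ∧
      ∀ k p, c k p ≠ 0 → |dotInt k p| ≤ 1 := by
  let a : (Fin d → ℤ) → Vec d → ℂ := fun k p => resSymbol (dotInt k p) * fproj k (cplx f) (p, 0)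
  have hneg : ∀ (k : Fin d → ℤ) (v : Vec d), dotInt (-k) v = -dotInt k v := by
    intro k v; simp [dotInt]
  have ha : ∀ k p, a k p ≠ 0 → |dotInt k p| ≤ 1 := by
    intro k p h
    by_contra! h1
    apply h
    simp [a, resSymbol, bump_eq_zero h1.le]
  -- Taking the real part averages the coefficient of `k` with the conjugate of that of `-k`; the
  -- set of modes and the resonance condition are both symmetric under `k ↦ -k`.
  refine ⟨fun k p => (a k p + (starRingEnd ℂ) (a (-k) p)) / 2, fun p q => ?_, fun k p h => ?_⟩
  · have h1 : multiplier resSymbol (modes d K) (cplx f) (p, q) =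
        ∑ k ∈ modes d K, a k p * Complex.exp (Complex.I * (dotInt k q : ℂ)) := by
      unfold multiplier
      refine Finset.sum_congr rfl fun k _ => ?_
      have : ((p, q) : Phase d) = (p, 0) + (0, q) := by simp
      rw [this, fproj_add k hp.cplx, dotL_apply]
      simp only [Prod.mk_add_mk, add_zero, zero_add, smul_eq_mul, a]
      ring
    have h2 : (starRingEnd ℂ) (∑ k ∈ modes d K, a k p * Complex.exp (Complex.I * (dotInt k q : ℂ))) =
        ∑ k ∈ modes d K, (starRingEnd ℂ) (a (-k) p) *
          Complex.exp (Complex.I * (dotInt k q : ℂ)) := by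
      rw [map_sum]
      refine Finset.sum_nbij' (fun k => -k) (fun k => -k) (fun k hk => neg_mem_modes hk)
        (fun k hk => neg_mem_modes hk) (fun k _ => neg_neg k) (fun k _ => neg_neg k) fun k _ => ?_
      rw [map_mul, neg_neg, ← Complex.exp_conj, hneg]
      simp
    rw [resPart, Complex.re_eq_add_conj, h1, h2, ← Finset.sum_add_distrib, Finset.sum_div]
    refine Finset.sum_congr rfl fun k _ => ?_
    ring
  · by_cases h1 : a k p = 0
    · have : a (-k) p ≠ 0 := by
        intro h2
        apply h
        simp [h1, h2]
      have := ha _ _ this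
      rwa [hneg, abs_neg] at this
    · exact ha _ _ h1

end Homological

end Nekhoroshev

end

noncomputable section

namespace Nekhoroshev

open scoped NNReal

/-! ### The Hamilton–Jacobi iteration -/

section HamiltonJacobi

variable {d : ℕ} {ι : Type}

/-- The vector representing the restriction of a linear form to the angles. -/
def gradQ : (Phase d →L[ℝ] ℝ) →L[ℝ] Vec d :=
  LinearMap.toContinuousLinearMap
    { toFun := fun l => WithLp.toLp 2 fun i => l (0, EuclideanSpace.single i 1)
      map_add' := fun l m => by ext i; simp
      map_smul' := fun c l => by ext i; simp }

/-- The vector representing the restriction of a linear form to the actions. -/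
def gradP : (Phase d →L[ℝ] ℝ) →L[ℝ] Vec d :=
  LinearMap.toContinuousLinearMap
    { toFun := fun l => WithLp.toLp 2 fun i => l (EuclideanSpace.single i 1, 0)
      map_add' := fun l m => by ext i; simp
      map_smul' := fun c l => by ext i; simp }

lemma sum_smul_single (v : Vec d) : ∑ i, v i • EuclideanSpace.single i (1 : ℝ) = v := by
  ext j
  simp [Finset.sum_apply, Pi.single_apply]

lemma inner_gradQ (l : Phase d →L[ℝ] ℝ) (v : Vec d) : inner ℝ (gradQ l) v = l (0, v) := by
  have h : ((0 : Vec d), v) =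
      ∑ i, v i • ((0 : Vec d), (EuclideanSpace.single i 1 : Vec d)) := by
    conv_lhs => rw [← sum_smul_single v]
    ext j <;> simp [Prod.fst_sum, Prod.snd_sum]
  rw [h, map_sum, PiLp.inner_apply]
  refine Finset.sum_congr rfl fun i _ => ?_
  rw [map_smul]
  simp [gradQ]

lemma inner_gradP (l : Phase d →L[ℝ] ℝ) (v : Vec d) : inner ℝ (gradP l) v = l (v, 0) := by
  have h : (v, (0 : Vec d)) =
      ∑ i, v i • ((EuclideanSpace.single i 1 : Vec d), (0 : Vec d)) := by
    conv_lhs => rw [← sum_smul_single v]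
    ext j <;> simp [Prod.fst_sum, Prod.snd_sum]
  rw [h, map_sum, PiLp.inner_apply]
  refine Finset.sum_congr rfl fun i _ => ?_
  rw [map_smul]
  simp [gradP]

/-- The scalar product of `Vec d` as a bilinear map. -/
def innerB : Vec d →L[ℝ] Vec d →L[ℝ] ℝ := innerSL ℝ

lemma innerB_apply (u v : Vec d) : innerB u v = inner ℝ u v := rfl

/-- The displacement `(∂_q S, 0)`. -/
def shiftP (S : Phase d → ℝ) (x : Phase d) : Phase d :=
  (ContinuousLinearMap.inl ℝ (Vec d) (Vec d)).comp gradQ (fderiv ℝ S x)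

/-- The displacement `(0, ∂_p S)`. -/
def shiftQ (S : Phase d → ℝ) (x : Phase d) : Phase d :=
  (ContinuousLinearMap.inr ℝ (Vec d) (Vec d)).comp gradP (fderiv ℝ S x)

lemma shiftP_eq (S : Phase d → ℝ) (x : Phase d) : shiftP S x = (gradQ (fderiv ℝ S x), 0) := rfl

lemma shiftQ_eq (S : Phase d → ℝ) (x : Phase d) : shiftQ S x = (0, gradP (fderiv ℝ S x)) := rfl

lemma UnifBdd.shiftP {S : ι → Phase d → ℝ} {η : ι → ℝ≥0} (hS : UnifBdd S η) :
    UnifBdd (fun i => Nekhoroshev.shiftP (S i)) η := hS.fderiv.clm _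

lemma UnifBdd.shiftQ {S : ι → Phase d → ℝ} {η : ι → ℝ≥0} (hS : UnifBdd S η) :
    UnifBdd (fun i => Nekhoroshev.shiftQ (S i)) η := hS.fderiv.clm _

lemma UnifBdd.gradQ {S : ι → Phase d → ℝ} {η : ι → ℝ≥0} (hS : UnifBdd S η) :
    UnifBdd (fun i x => Nekhoroshev.gradQ (_root_.fderiv ℝ (S i) x)) η := hS.fderiv.clm _

/-- The right-hand side of the Hamilton–Jacobi equation for the generating function `S` and the
normal form `Z`. -/
def hjRHS (μ : ℝ≥0) (W S Z : Phase d → ℝ) (x : Phase d) : ℝ :=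
  (μ : ℝ) • W (x + shiftP S x) +
    (1 / 2 : ℝ) • innerB (gradQ (fderiv ℝ S x)) (gradQ (fderiv ℝ S x)) -
    (Z (x + shiftQ S x) - Z x)

variable {W S S' Z Z' : ι → Phase d → ℝ} {μ θ : ι → ℝ≥0}

lemma UnifBdd.hjRHS (hμ : μ ≤ 1) (hW : UnifBdd W 1) (hS : UnifBdd S μ) (hZ : UnifBdd Z μ) :
    UnifBdd (fun i => Nekhoroshev.hjRHS (μ i) (W i) (S i) (Z i)) μ := by
  have h1 := (hW.comp_id_add (hS.shiftP.mono_le hμ)).smul_const μ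
  have h2 := (hS.gradQ.bilin innerB hS.gradQ).clm
    ((1 / 2 : ℝ) • ContinuousLinearMap.id ℝ ℝ)
  have h3 := hZ.comp_id_add (hS.shiftQ.mono_le hμ)
  rw [mul_one] at h1
  have h2' := h2.mono_le (θ := μ) fun i => mul_le_of_le_one_right zero_le (hμ i)
  exact (h1.add h2').sub (h3.sub hZ)

/-- The contraction estimate. The `W` term carries the prefactor `μ`, the quadratic term factors as
`½ ⟨g + g', g - g'⟩` with `g + g' = O(μ)`, and the `Z` terms gain `μ` either from the shift or from
`Z'` itself. -/
lemma UnifBdd.hjRHS_sub (hμ : μ ≤ 1) (hW : UnifBdd W 1) (hS : UnifBdd S μ)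
    (hS' : UnifBdd S' μ) (hZ' : UnifBdd Z' μ)
    (hSS : UnifBdd (fun i x => S i x - S' i x) θ) (hZZ : UnifBdd (fun i x => Z i x - Z' i x) θ) :
    UnifBdd (fun i x => Nekhoroshev.hjRHS (μ i) (W i) (S i) (Z i) x -
      Nekhoroshev.hjRHS (μ i) (W i) (S' i) (Z' i) x) (μ * θ) := by
  have hfd : ∀ i x, _root_.fderiv ℝ (fun x => S i x - S' i x) x =
      _root_.fderiv ℝ (S i) x - _root_.fderiv ℝ (S' i) x := fun i x =>
    fderiv_fun_sub ((hS.smooth i).differentiable (by simp) x)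
      ((hS'.smooth i).differentiable (by simp) x)
  have hPd : UnifBdd (fun i x => Nekhoroshev.shiftP (S i) x - Nekhoroshev.shiftP (S' i) x) θ := by
    have := hSS.shiftP
    unfold Nekhoroshev.shiftP at this ⊢
    simpa only [hfd, map_sub] using this
  have hQd : UnifBdd (fun i x => Nekhoroshev.shiftQ (S i) x - Nekhoroshev.shiftQ (S' i) x) θ := by
    have := hSS.shiftQ
    unfold Nekhoroshev.shiftQ at this ⊢
    simpa only [hfd, map_sub] using this
  have hgd : UnifBdd (fun i x => Nekhoroshev.gradQ (_root_.fderiv ℝ (S i) x) -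
      Nekhoroshev.gradQ (_root_.fderiv ℝ (S' i) x)) θ := by
    have := hSS.gradQ
    simpa only [hfd, map_sub] using this
  have hP1 := hS.shiftP.mono_le hμ
  have hP1' := hS'.shiftP.mono_le hμ
  have hQ1 := hS.shiftQ.mono_le hμ
  have hQ1' := hS'.shiftQ.mono_le hμ
  have h1 := (hW.comp_sub hP1 hP1' hPd).smul_const μ
  rw [one_mul] at h1
  have h2 := ((hS.gradQ.add hS'.gradQ).bilin innerB hgd).clm
    ((1 / 2 : ℝ) • ContinuousLinearMap.id ℝ ℝ)
  have hzero : UnifBdd (fun (_ : ι) (_ : Phase d) => (0 : Phase d)) 1 := UnifBdd.const 0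
  -- The increment of `Z - Z'` under the shift is a comparison with the zero displacement, so it
  -- gains the size `μ` of the shift.
  have h3 := hZZ.comp_sub hQ1 hzero (θ := μ) (by simpa using hS.shiftQ)
  rw [mul_comm] at h3
  have h4 := hZ'.comp_sub hQ1 hQ1' hQd
  refine cast ?_ (((h1.add h2).sub h3).sub h4)
  congr 1
  funext i x
  simp only [Nekhoroshev.hjRHS, add_zero, FunLike.coe_smul, Pi.smul_apply,
    ContinuousLinearMap.coe_id', id_eq, smul_eq_mul, innerB_apply, inner_add_left,
    inner_sub_right]
  rw [real_inner_comm (Nekhoroshev.gradQ (_root_.fderiv ℝ (S' i) x))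
    (Nekhoroshev.gradQ (_root_.fderiv ℝ (S i) x))]
  ring

/-- The iterates of the Hamilton–Jacobi equation. -/
def hjIter (μ : ℝ≥0) (K : ℕ) (W : Phase d → ℝ) : ℕ → Phase d → ℝ
  | 0 => hjRHS μ W (fun _ => 0) (fun _ => 0)
  | n + 1 => hjRHS μ W (homSol K (hjIter μ K W n)) (resPart K (hjIter μ K W n))

lemma PeriodicAng.hjRHS {W S Z : Phase d → ℝ} (hW : PeriodicAng W) (hS : PeriodicAng S)
    (hZ : PeriodicAng Z) (μ : ℝ≥0) : PeriodicAng (Nekhoroshev.hjRHS μ W S Z) := by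
  intro x k
  simp only [Nekhoroshev.hjRHS, shiftP, shiftQ, hS.fderiv x k, hZ x k]
  rw [add_right_comm x, hW, add_right_comm x, hZ]

lemma periodicAng_hjIter {W : Phase d → ℝ} (hW : PeriodicAng W) (μ : ℝ≥0) (K n : ℕ) :
    PeriodicAng (hjIter μ K W n) := by
  induction n with
  | zero => exact hW.hjRHS (fun _ _ => rfl) (fun _ _ => rfl) μ
  | succ n ih => exact hW.hjRHS (ih.homSol K) (ih.resPart K) μ

lemma UnifBdd.zero (η : ι → ℝ≥0) : UnifBdd (fun (_ : ι) (_ : Phase d) => (0 : ℝ)) η where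
  smooth _ := contDiff_const
  bdd n := ⟨0, fun i x => by simp⟩

lemma unifBdd_hjIter (hμ : μ ≤ 1) (hW : UnifBdd W 1) (hp : ∀ i, PeriodicAng (W i)) (K : ι → ℕ)
    (n : ℕ) : UnifBdd (fun i => hjIter (μ i) (K i) (W i) n) μ := by
  induction n with
  | zero => exact UnifBdd.hjRHS hμ hW (UnifBdd.zero _) (UnifBdd.zero _)
  | succ n ih =>
    have hpn : ∀ i, PeriodicAng (hjIter (μ i) (K i) (W i) n) := fun i =>
      periodicAng_hjIter (hp i) _ _ n
    exact UnifBdd.hjRHS hμ hW (ih.homSol hpn K) (ih.resPart hpn K)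

/-- Each step gains one factor `μ` from `UnifBdd.hjRHS_sub`. The exponent starts at `2` because the
zeroth iterate, made from `S = Z = 0`, already produces corrections of size `μ`. -/
lemma unifBdd_hjIter_sub (hμ : μ ≤ 1) (hW : UnifBdd W 1) (hp : ∀ i, PeriodicAng (W i))
    (K : ι → ℕ) (n : ℕ) :
    UnifBdd (fun i x => hjIter (μ i) (K i) (W i) (n + 1) x - hjIter (μ i) (K i) (W i) n x)
      (μ ^ (n + 2)) := by
  have hG := unifBdd_hjIter hμ hW hp K
  have hpn : ∀ n i, PeriodicAng (hjIter (μ i) (K i) (W i) n) := fun n i =>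
    periodicAng_hjIter (hp i) _ _ n
  induction n with
  | zero =>
    have := UnifBdd.hjRHS_sub hμ hW ((hG 0).homSol (hpn 0) K)
      (UnifBdd.zero _) (UnifBdd.zero _) (by simpa using (hG 0).homSol (hpn 0) K)
      (by simpa using (hG 0).resPart (hpn 0) K)
    rw [zero_add, pow_two]
    exact this
  | succ n ih =>
    have hpd : ∀ i, PeriodicAng fun x =>
        hjIter (μ i) (K i) (W i) (n + 1) x - hjIter (μ i) (K i) (W i) n x := fun i x k => by
      simp only [hpn (n + 1) i x k, hpn n i x k]
    have hc : ∀ n i, Continuous (hjIter (μ i) (K i) (W i) n) := fun n i =>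
      ((hG n).smooth i).continuous
    have hS := ih.homSol hpd K
    have hZ := ih.resPart hpd K
    have e1 : (fun i => homSol (K i) fun x =>
        hjIter (μ i) (K i) (W i) (n + 1) x - hjIter (μ i) (K i) (W i) n x) = fun i x =>
        homSol (K i) (hjIter (μ i) (K i) (W i) (n + 1)) x -
          homSol (K i) (hjIter (μ i) (K i) (W i) n) x := by
      funext i x
      exact homSol_sub (K i) (hc (n + 1) i) (hc n i) x
    have e2 : (fun i => resPart (K i) fun x =>
        hjIter (μ i) (K i) (W i) (n + 1) x - hjIter (μ i) (K i) (W i) n x) = fun i x =>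
        resPart (K i) (hjIter (μ i) (K i) (W i) (n + 1)) x -
          resPart (K i) (hjIter (μ i) (K i) (W i) n) x := by
      funext i x
      exact resPart_sub (K i) (hc (n + 1) i) (hc n i) x
    rw [e1] at hS
    rw [e2] at hZ
    have := UnifBdd.hjRHS_sub hμ hW ((hG (n + 1)).homSol (hpn (n + 1)) K)
      ((hG n).homSol (hpn n) K)
      ((hG n).resPart (hpn n) K) hS hZ
    rw [pow_succ' μ (n + 2)]
    exact this

lemma freeH_eq (x : Phase d) : freeH x = inner ℝ x.1 x.1 / 2 := by
  rw [PiLp.inner_apply, Finset.sum_div]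
  simp [freeH, sq]

/-- The defect in the Hamilton–Jacobi equation. -/
def hjDefect (μ : ℝ≥0) (W S Z : Phase d → ℝ) (x : Phase d) : ℝ :=
  freeH (x + shiftP S x) + μ * W (x + shiftP S x) -
    (freeH (x + shiftQ S x) + Z (x + shiftQ S x))

/-- Expand the square in `H₀ (p + ∂_q S)`; the shift in the angles does not affect `H₀`. -/
lemma hjDefect_eq (μ : ℝ≥0) (W S Z : Phase d → ℝ) (x : Phase d) :
    hjDefect μ W S Z x = fderiv ℝ S x (0, x.1) + hjRHS μ W S Z x - Z x := by
  simp only [hjDefect, hjRHS, freeH_eq, shiftP_eq, shiftQ_eq, Prod.fst_add, add_zero, inner_add_left,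
    inner_add_right, innerB_apply, smul_eq_mul]
  rw [real_inner_comm (gradQ (fderiv ℝ S x)) x.1, inner_gradQ]
  ring

/-- Approximate solution of the Hamilton–Jacobi equation to any order. -/
lemma exists_hj_solution (hμ : μ ≤ 1) (hW : UnifBdd W 1) (hp : ∀ i, PeriodicAng (W i))
    (K : ι → ℕ) (n N : ℕ) :
    ∃ S Z : ι → Phase d → ℝ, UnifBdd S μ ∧ UnifBdd Z μ ∧ (∀ i, PeriodicAng (S i)) ∧
      UnifBdd (fun i => hjDefect (μ i) (W i) (S i) (Z i))
        (fun i => μ i ^ n + ((1 + (K i : ℝ≥0)) ^ N)⁻¹) ∧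
      ∀ i, ∃ c : (Fin d → ℤ) → Vec d → ℂ,
        (∀ p q : Vec d, (Z i (p, q) : ℂ) =
          ∑ k ∈ modes d (K i), c k p * Complex.exp (Complex.I * (dotInt k q : ℂ))) ∧
        ∀ k p, c k p ≠ 0 → |dotInt k p| ≤ 1 := by
  have hG := unifBdd_hjIter hμ hW hp K n
  have hpn : ∀ i, PeriodicAng (hjIter (μ i) (K i) (W i) n) := fun i =>
    periodicAng_hjIter (hp i) _ _ n
  refine ⟨fun i => homSol (K i) (hjIter (μ i) (K i) (W i) n),
    fun i => resPart (K i) (hjIter (μ i) (K i) (W i) n), hG.homSol hpn K, hG.resPart hpn K,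
    fun i => (hpn i).homSol (K i), ?_, fun i => exists_resPart_coeff (hpn i) (K i)⟩
  -- With `S` and `Z` built from the `n`-th iterate, the defect is the Fourier tail of that iterate
  -- plus the difference to the next iterate.
  have h1 := ((hG.cplx.tail (fun i => (hpn i).cplx) K N).clm Complex.reCLM).mono_le
    (θ := fun i => μ i ^ n + ((1 + (K i : ℝ≥0)) ^ N)⁻¹) fun i =>
      (mul_le_of_le_one_right zero_le (hμ i)).trans (le_add_of_nonneg_left zero_le)
  have h2 := (unifBdd_hjIter_sub hμ hW hp K n).mono_le
    (θ := fun i => μ i ^ n + ((1 + (K i : ℝ≥0)) ^ N)⁻¹) fun i =>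
      (pow_le_pow_of_le_one zero_le (hμ i) (by omega)).trans (le_add_of_nonneg_right zero_le)
  refine cast ?_ (h1.add h2)
  congr 1
  funext i x
  rw [hjDefect_eq, Complex.reCLM_apply, ← fderiv_homSol_add hG hpn i (K i) x]
  simp only [hjIter]
  ring

end HamiltonJacobi

end Nekhoroshev

end

noncomputable section

namespace Nekhoroshev

open scoped NNReal

/-! ### Canonical transformations from generating functions -/

section NearIdentity

set_option linter.unusedSectionVars false

variable {X : Type} [NormedAddCommGroup X] [NormedSpace ℝ X] [CompleteSpace X] {u : X → X}

/-- A perturbation of the identity with Lipschitz constant `1/2` is a global homeomorphism, and its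
derivative is invertible by the Neumann series, so the inverse is smooth. -/
lemma exists_smooth_inverse_id_add (hu : ContDiff ℝ ∞ u) (hd : ∀ x, ‖fderiv ℝ u x‖ ≤ 1 / 2) :
    ∃ g : X → X, ContDiff ℝ ∞ g ∧ (∀ x, g (x + u x) = x) ∧ ∀ y, g y + u (g y) = y := by
  have hdiff : Differentiable ℝ u := hu.differentiable (by simp)
  have happ : ApproximatesLinearOn (fun x => x + u x)
      ((ContinuousLinearEquiv.refl ℝ X : X ≃L[ℝ] X) : X →L[ℝ] X) Set.univ (1 / 2 : ℝ≥0) := by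
    intro x _ y _
    have : x + u x - (y + u y) -
        ((ContinuousLinearEquiv.refl ℝ X : X ≃L[ℝ] X) : X →L[ℝ] X) (x - y) = u x - u y := by
      simp; abel
    rw [this]
    simpa using convex_univ.norm_image_sub_le_of_norm_fderiv_le (𝕜 := ℝ)
      (fun z _ => hdiff z) (fun z _ => hd z) (Set.mem_univ y) (Set.mem_univ x)
  have hc : Subsingleton X ∨ (1 / 2 : ℝ≥0) <
      ‖((ContinuousLinearEquiv.refl ℝ X).symm : X →L[ℝ] X)‖₊⁻¹ := by
    rcases subsingleton_or_nontrivial X with h | h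
    · exact Or.inl h
    · right
      have : ‖((ContinuousLinearEquiv.refl ℝ X).symm : X →L[ℝ] X)‖₊ = 1 := by
        rw [← NNReal.coe_inj]
        exact ContinuousLinearMap.norm_id
      rw [this, inv_one]
      exact NNReal.half_lt_self one_ne_zero
  let h := happ.toHomeomorph _ hc
  have hh : ∀ x, h x = x + u x := fun x => rfl
  have hlt : ∀ x, ‖-fderiv ℝ u x‖ < 1 := fun x => by
    rw [norm_neg]; linarith [hd x]
  let e : X → X ≃L[ℝ] X := fun x =>
    ContinuousLinearEquiv.unitsEquiv ℝ X (Units.oneSub (-fderiv ℝ u x) (hlt x))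
  have he : ∀ x, HasFDerivAt h (e x : X →L[ℝ] X) x := by
    intro x
    have h1 : (e x : X →L[ℝ] X) = ContinuousLinearMap.id ℝ X + fderiv ℝ u x := by
      ext y
      simp [e, ContinuousLinearEquiv.unitsEquiv_apply]
    rw [h1]
    exact (hasFDerivAt_id x).add (hdiff x).hasFDerivAt
  refine ⟨h.symm, h.contDiff_symm he (contDiff_id.add hu), fun x => ?_, fun y => ?_⟩
  · rw [← hh]; exact h.symm_apply_apply x
  · rw [← hh]; exact h.apply_symm_apply y

variable {g : X → X}

lemma fderiv_inverse_eq (hu : ContDiff ℝ ∞ u) (hg : ContDiff ℝ ∞ g) (hr : ∀ y, g y + u (g y) = y)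
    (y : X) : fderiv ℝ g y = ContinuousLinearMap.id ℝ X - (fderiv ℝ u (g y)).comp (fderiv ℝ g y) := by
  have h1 : HasFDerivAt (fun y => g y + u (g y))
      (fderiv ℝ g y + (fderiv ℝ u (g y)).comp (fderiv ℝ g y)) y :=
    (hg.differentiable (by simp) y).hasFDerivAt.add
      ((hu.differentiable (by simp) _).hasFDerivAt.comp y (hg.differentiable (by simp) y).hasFDerivAt)
  have h2 : (fun y => g y + u (g y)) = id := funext hr
  rw [h2] at h1
  have := h1.unique (hasFDerivAt_id y)
  rw [← this]
  abel

lemma norm_fderiv_inverse_le (hu : ContDiff ℝ ∞ u) (hd : ∀ x, ‖fderiv ℝ u x‖ ≤ 1 / 2)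
    (hg : ContDiff ℝ ∞ g) (hr : ∀ y, g y + u (g y) = y) (y : X) : ‖fderiv ℝ g y‖ ≤ 2 := by
  apply ContinuousLinearMap.opNorm_le_bound _ zero_le_two
  intro z
  have h1 := congrArg (fun L => L z) (fderiv_inverse_eq hu hg hr y)
  simp only [sub_apply, ContinuousLinearMap.id_apply, ContinuousLinearMap.comp_apply] at h1
  have h2 : ‖fderiv ℝ g y z‖ ≤ ‖z‖ + 1 / 2 * ‖fderiv ℝ g y z‖ := by
    calc ‖fderiv ℝ g y z‖ = ‖z - fderiv ℝ u (g y) (fderiv ℝ g y z)‖ := by rw [← h1]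
      _ ≤ ‖z‖ + ‖fderiv ℝ u (g y) (fderiv ℝ g y z)‖ := norm_sub_le _ _
      _ ≤ _ := by
        gcongr
        exact (ContinuousLinearMap.le_opNorm _ _).trans (by gcongr; exact hd _)
  linarith

/-- Differentiating `Dg = 1 - Du ∘ Dg` gives `‖Q‖ ≤ ½ ‖Q‖ + 4 B ‖z‖` for `Q = D²g z`, and half of
`‖Q‖` is absorbed on the left. -/
lemma norm_fderiv_fderiv_inverse_le (hu : ContDiff ℝ ∞ u) (hd : ∀ x, ‖fderiv ℝ u x‖ ≤ 1 / 2)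
    {B : ℝ} (hB : ∀ x, ‖fderiv ℝ (fderiv ℝ u) x‖ ≤ B)
    (hg : ContDiff ℝ ∞ g) (hr : ∀ y, g y + u (g y) = y) (y : X) :
    ‖fderiv ℝ (fderiv ℝ g) y‖ ≤ 8 * B := by
  have hB0 : 0 ≤ B := (norm_nonneg _).trans (hB y)
  have hg' : ContDiff ℝ ∞ (fderiv ℝ g) := hg.fderiv_right (by simp)
  have hu' : ContDiff ℝ ∞ (fderiv ℝ u) := hu.fderiv_right (by simp)
  have hDg := norm_fderiv_inverse_le hu hd hg hr y
  have h1 : HasFDerivAt (fun y => fderiv ℝ u (g y))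
      ((fderiv ℝ (fderiv ℝ u) (g y)).comp (fderiv ℝ g y)) y :=
    (hu'.differentiable (by simp) _).hasFDerivAt.comp y (hg.differentiable (by simp) y).hasFDerivAt
  have h2 := (hg'.differentiable (by simp) y).hasFDerivAt
  have h3 := (h1.clm_comp h2).const_sub (ContinuousLinearMap.id ℝ X)
  have h4 : (fun y => ContinuousLinearMap.id ℝ X - (fderiv ℝ u (g y)).comp (fderiv ℝ g y)) =
      fderiv ℝ g := funext fun y => (fderiv_inverse_eq hu hg hr y).symm
  rw [h4] at h3
  have h5 := h3.fderiv
  apply ContinuousLinearMap.opNorm_le_bound _ (by positivity)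
  intro z
  set Q := fderiv ℝ (fderiv ℝ g) y z with hQ
  have h6 : Q = -((fderiv ℝ u (g y)).comp Q +
      (fderiv ℝ (fderiv ℝ u) (g y) (fderiv ℝ g y z)).comp (fderiv ℝ g y)) := by
    conv_lhs => rw [hQ, h5]
    rfl
  have h7 : ‖Q‖ ≤ 1 / 2 * ‖Q‖ + B * (2 * ‖z‖) * 2 := by
    calc ‖Q‖ = ‖(fderiv ℝ u (g y)).comp Q +
          (fderiv ℝ (fderiv ℝ u) (g y) (fderiv ℝ g y z)).comp (fderiv ℝ g y)‖ := by
            conv_lhs => rw [h6, norm_neg]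
      _ ≤ ‖fderiv ℝ u (g y)‖ * ‖Q‖ +
          ‖fderiv ℝ (fderiv ℝ u) (g y) (fderiv ℝ g y z)‖ * ‖fderiv ℝ g y‖ :=
        (norm_add_le _ _).trans (add_le_add (ContinuousLinearMap.opNorm_comp_le _ _)
          (ContinuousLinearMap.opNorm_comp_le _ _))
      _ ≤ _ := by
        gcongr
        · exact hd _
        · refine (ContinuousLinearMap.le_opNorm _ _).trans ?_
          gcongr
          · exact hB _
          · exact (ContinuousLinearMap.le_opNorm _ _).trans (by gcongr)
  linarith

/-- Composition with the inverse of a near-identity map preserves `C²` bounds. -/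
lemma norm_iteratedFDeriv_comp_inverse_le {F : Type} [NormedAddCommGroup F] [NormedSpace ℝ F]
    {E : X → F} (hE : ContDiff ℝ ∞ E) {a : ℝ} (ha : ∀ n ≤ 2, ∀ x, ‖iteratedFDeriv ℝ n E x‖ ≤ a)
    (hu : ContDiff ℝ ∞ u) (hd : ∀ x, ‖fderiv ℝ u x‖ ≤ 1 / 2)
    {B : ℝ} (hB : ∀ x, ‖fderiv ℝ (fderiv ℝ u) x‖ ≤ B)
    (hg : ContDiff ℝ ∞ g) (hr : ∀ y, g y + u (g y) = y) {n : ℕ} (hn : n ≤ 2) (y : X) :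
    ‖iteratedFDeriv ℝ n (fun y => E (g y)) y‖ ≤ 2 * (2 + 8 * B) ^ 2 * a := by
  have hB0 : 0 ≤ B := (norm_nonneg _).trans (hB y)
  have ha0 : 0 ≤ a := (norm_nonneg _).trans (ha 0 (by omega) y)
  -- The constant `D = 2 + 8 * B` dominates `‖Dg‖`, and `D ^ 2` dominates `‖D²g‖`; the factor `2` in
  -- the result is `2!`.
  have h1 := norm_iteratedFDeriv_comp_le hE hg (n := n) (by exact_mod_cast le_top) y (C := a)
    (D := 2 + 8 * B) (fun i hi => ha i (hi.trans hn) _) ?_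
  · refine h1.trans ?_
    have h2 : (n.factorial : ℝ) ≤ 2 := by
      have : n.factorial ≤ Nat.factorial 2 := Nat.factorial_le hn
      exact_mod_cast this
    have h3 : (2 + 8 * B) ^ n ≤ (2 + 8 * B) ^ 2 := pow_le_pow_right₀ (by linarith) hn
    calc (n.factorial : ℝ) * a * (2 + 8 * B) ^ n ≤ 2 * a * (2 + 8 * B) ^ 2 := by gcongr
      _ = _ := by ring
  · intro i h1i hi
    have : i = 1 ∨ i = 2 := by omega
    rcases this with rfl | rfl
    · rw [norm_iteratedFDeriv_one, pow_one]
      have := norm_fderiv_inverse_le hu hd hg hr y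
      linarith
    · rw [← norm_iteratedFDeriv_fderiv, norm_iteratedFDeriv_one]
      refine (norm_fderiv_fderiv_inverse_le hu hd hB hg hr y).trans ?_
      nlinarith

end NearIdentity

section Canonical

variable {d : ℕ} {S : Phase d → ℝ}

lemma contDiff_shiftP (hS : ContDiff ℝ ∞ S) : ContDiff ℝ ∞ (shiftP S) :=
  (ContinuousLinearMap.contDiff _).comp (hS.fderiv_right (by simp))

lemma contDiff_shiftQ (hS : ContDiff ℝ ∞ S) : ContDiff ℝ ∞ (shiftQ S) :=
  (ContinuousLinearMap.contDiff _).comp (hS.fderiv_right (by simp))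

lemma hasFDerivAt_shiftP (hS : ContDiff ℝ ∞ S) (x : Phase d) :
    HasFDerivAt (shiftP S) (((ContinuousLinearMap.inl ℝ (Vec d) (Vec d)).comp gradQ).comp
      (fderiv ℝ (fderiv ℝ S) x)) x :=
  (ContinuousLinearMap.hasFDerivAt _).comp x
    ((hS.fderiv_right (m := ∞) (by simp)).differentiable (by simp) x).hasFDerivAt

lemma hasFDerivAt_shiftQ (hS : ContDiff ℝ ∞ S) (x : Phase d) :
    HasFDerivAt (shiftQ S) (((ContinuousLinearMap.inr ℝ (Vec d) (Vec d)).comp gradP).comp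
      (fderiv ℝ (fderiv ℝ S) x)) x :=
  (ContinuousLinearMap.hasFDerivAt _).comp x
    ((hS.fderiv_right (m := ∞) (by simp)).differentiable (by simp) x).hasFDerivAt

/-- The maps `(p, q) ↦ (p + ∂_q S, q)` and `(p, q) ↦ (p, q + ∂_p S)` pull back the symplectic form
to the same form. -/
lemma symplForm_shift_eq (hS : ContDiff ℝ ∞ S) (x a b : Phase d) :
    symplForm (a + fderiv ℝ (shiftP S) x a) (b + fderiv ℝ (shiftP S) x b) =
      symplForm (a + fderiv ℝ (shiftQ S) x a) (b + fderiv ℝ (shiftQ S) x b) := by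
  -- Symmetry of the Hessian of `S` is what makes the two pullbacks agree.
  have hsymm : fderiv ℝ (fderiv ℝ S) x a b = fderiv ℝ (fderiv ℝ S) x b a :=
    (hS.contDiffAt.isSymmSndFDerivAt (by simpa using ENat.LEInfty.out)) a b
  rw [(hasFDerivAt_shiftP hS x).fderiv, (hasFDerivAt_shiftQ hS x).fderiv]
  set H := fderiv ℝ (fderiv ℝ S) x
  have ha : H b a = H b (a.1, 0) + H b (0, a.2) := by rw [← map_add]; simp
  have hb : H a b = H a (b.1, 0) + H a (0, b.2) := by rw [← map_add]; simp
  simp only [symplForm, ContinuousLinearMap.comp_apply, ContinuousLinearMap.inl_apply,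
    ContinuousLinearMap.inr_apply, Prod.fst_add, Prod.snd_add, add_zero, inner_add_left,
    inner_add_right, inner_gradQ, inner_gradP]
  rw [real_inner_comm (gradQ (H b)) a.2, real_inner_comm (gradP (H b)) a.1, inner_gradQ, inner_gradP]
  linarith

/-- The canonical transformation with generating function `S`. -/
lemma exists_canonical (hS : ContDiff ℝ ∞ S) (hp : PeriodicAng S)
    (hP : ∀ x, ‖fderiv ℝ (shiftP S) x‖ ≤ 1 / 2) (hQ : ∀ x, ‖fderiv ℝ (shiftQ S) x‖ ≤ 1 / 2) :
    ∃ T g : Phase d → Phase d, IsCanonical T ∧ ContDiff ℝ ∞ g ∧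
      (∀ x, g x + shiftQ S (g x) = x) ∧ ∀ x, T x = g x + shiftP S (g x) := by
  obtain ⟨g, hg, hgl, hgr⟩ := exists_smooth_inverse_id_add (contDiff_shiftQ hS) hQ
  obtain ⟨h, hh, hhl, hhr⟩ := exists_smooth_inverse_id_add (contDiff_shiftP hS) hP
  have hshP : ∀ x k, shiftP S (x + (0, latticeVec k)) = shiftP S x := fun x k => by
    simp only [shiftP, hp.fderiv x k]
  have hshQ : ∀ x k, shiftQ S (x + (0, latticeVec k)) = shiftQ S x := fun x k => by
    simp only [shiftQ, hp.fderiv x k]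
  have hgeq : ∀ x k, g (x + (0, latticeVec k)) = g x + (0, latticeVec k) := by
    intro x k
    have h1 := hgl (g x + (0, latticeVec k))
    rw [hshQ, add_right_comm, hgr] at h1
    exact h1
  refine ⟨fun x => g x + shiftP S (g x), g, ?_, hg, hgr, fun x => rfl⟩
  refine ⟨hg.add ((contDiff_shiftP hS).comp hg), ?_, ?_, ?_⟩
  · intro p q k
    have h1 : ((p, q + latticeVec k) : Phase d) = (p, q) + (0, latticeVec k) := by simp
    simp only [h1, hgeq, hshP]
    rw [add_right_comm]
  -- Here `T = (id + shiftP) ∘ (id + shiftQ)⁻¹`, so the inverse exchanges the two factors. It is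
  -- symplectic because both factors pull the form back to the same form.
  · refine ⟨fun x => h x + shiftQ S (h x), hh.add ((contDiff_shiftQ hS).comp hh), fun x => ?_,
      fun x => ?_⟩
    · simp only [hhl, hgr]
    · simp only [hgl, hhr]
  · intro x u v
    have hTd : HasFDerivAt (fun x => g x + shiftP S (g x))
        (fderiv ℝ g x + (fderiv ℝ (shiftP S) (g x)).comp (fderiv ℝ g x)) x :=
      (hg.differentiable (by simp) x).hasFDerivAt.add
        (((contDiff_shiftP hS).differentiable (by simp) _).hasFDerivAt.comp x
          (hg.differentiable (by simp) x).hasFDerivAt)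
    have hinv : ∀ w, fderiv ℝ g x w + fderiv ℝ (shiftQ S) (g x) (fderiv ℝ g x w) = w := by
      intro w
      have h1 := congrArg (fun L => L w) (fderiv_inverse_eq (contDiff_shiftQ hS) hg hgr x)
      simp only [sub_apply, ContinuousLinearMap.id_apply, ContinuousLinearMap.comp_apply] at h1
      rw [eq_sub_iff_add_eq] at h1
      exact h1
    rw [hTd.fderiv]
    have h2 := symplForm_shift_eq hS (g x) (fderiv ℝ g x u) (fderiv ℝ g x v)
    rw [hinv, hinv] at h2
    exact h2

end Canonical

end Nekhoroshev

end

noncomputable section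

namespace Nekhoroshev

open scoped NNReal

/-! ### Global existence of solutions -/

/-- A globally Lipschitz smooth vector field has global integral curves. -/
lemma exists_global_solution {X : Type} [NormedAddCommGroup X] [NormedSpace ℝ X] [CompleteSpace X]
    {v : X → X} (hv : ContDiff ℝ 1 v) {L : ℝ≥0} (hL : LipschitzWith L v) (x₀ : X) :
    ∃ γ : ℝ → X, γ 0 = x₀ ∧ ∀ t, HasDerivAt γ (v (γ t)) t := by
  -- A time of existence independent of the starting point: on the ball of radius `a = ‖v x‖ + 1`
  -- the field is at most `(1 + L) * a`, and `τ` times this is exactly `a`. Solutions on intervals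
  -- of uniform length then extend to all times.
  let τ : ℝ := (1 + (L : ℝ))⁻¹
  have hτ : 0 < τ := by positivity
  have hloc : ∀ x : X, ∃ γ : ℝ → X, γ 0 = x ∧ IsMIntegralCurveOn (I := modelWithCornersSelf ℝ X)
      γ (v : (x : X) → TangentSpace (modelWithCornersSelf ℝ X) x) (Set.Ioo (-τ) τ) := by
    intro x
    let a : ℝ≥0 := ‖v x‖₊ + 1
    have hpl : IsPicardLindelof (fun _ => v) (tmin := -τ) (tmax := τ)
        ⟨0, by constructor <;> linarith⟩ x a 0 ((1 + L) * a) L := by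
      refine ⟨fun t _ => hL.lipschitzOnWith, fun x _ => continuousOn_const, fun t _ y hy => ?_, ?_⟩
      · have h1 : ‖v y - v x‖ ≤ L * a := by
          refine (hL.norm_sub_le y x).trans ?_
          gcongr
          simpa [dist_eq_norm] using hy
        have h2 : ‖v y‖ ≤ ‖v x‖ + ‖v y - v x‖ := by
          simpa using norm_add_le (v x) (v y - v x)
        have h3 : ‖v x‖ ≤ a := by simp [a]
        push_cast
        linarith
      · simp only [sub_zero, zero_sub, neg_neg, max_self, NNReal.coe_zero]
        push_cast
        apply le_of_eq
        simp only [τ]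
        field_simp
    obtain ⟨α, h0, hα⟩ := hpl.exists_eq_forall_mem_Icc_hasDerivWithinAt₀
    refine ⟨α, h0, fun t ht => ?_⟩
    have h1 := (hα t (Set.Ioo_subset_Icc_self ht)).hasFDerivWithinAt.mono
      (Set.Ioo_subset_Icc_self)
    exact h1.hasMFDerivWithinAt
  have hvm : ContMDiff (modelWithCornersSelf ℝ X) (modelWithCornersSelf ℝ X).tangent 1
      (fun x => (⟨x, v x⟩ : TangentBundle (modelWithCornersSelf ℝ X) X)) :=
    contMDiff_vectorSpace_iff_contDiff.2 hv
  obtain ⟨γ, h0, hγ⟩ := exists_isMIntegralCurve_of_isMIntegralCurveOn hvm hτ hloc x₀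
  refine ⟨γ, h0, fun t => ?_⟩
  have h1 : HasFDerivAt γ ((ContinuousLinearMap.id ℝ ℝ).smulRight (v (γ t))) t :=
    hasMFDerivAt_iff_hasFDerivAt.1 (hγ t)
  simpa using h1.hasDerivAt

end Nekhoroshev

end

noncomputable section

namespace Nekhoroshev

open scoped NNReal

/-! ### Dynamics of Hamiltonians in normal form -/

section Dynamics

variable {d : ℕ}

lemma gradient_eq_of_hasFDerivAt {f : Vec d → ℝ} {l : Vec d →L[ℝ] ℝ} {x w : Vec d}
    (hf : HasFDerivAt f l x) (hw : ∀ v, inner ℝ w v = l v) : gradient f x = w := by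
  apply HasGradientAt.gradient
  rw [hasGradientAt_iff_hasFDerivAt]
  have h : InnerProductSpace.toDual ℝ (Vec d) w = l :=
    ContinuousLinearMap.ext fun v => by rw [InnerProductSpace.toDual_apply_apply]; exact hw v
  rw [h]
  exact hf

lemma hamField_eq {H : Phase d → ℝ} {x : Phase d} (hH : DifferentiableAt ℝ H x) :
    hamField H x = (-gradQ (fderiv ℝ H x), gradP (fderiv ℝ H x)) := by
  have hH' : HasFDerivAt H (fderiv ℝ H x) (x.1, x.2) := hH.hasFDerivAt
  have h1 : HasFDerivAt (fun q => H (x.1, q))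
      ((fderiv ℝ H x).comp (ContinuousLinearMap.inr ℝ (Vec d) (Vec d))) x.2 :=
    hH'.comp x.2 (hasFDerivAt_prodMk_right x.1 x.2)
  have h2 : HasFDerivAt (fun p => H (p, x.2))
      ((fderiv ℝ H x).comp (ContinuousLinearMap.inl ℝ (Vec d) (Vec d))) x.1 :=
    hH'.comp x.1 (hasFDerivAt_prodMk_left x.1 x.2)
  rw [hamField, gradient_eq_of_hasFDerivAt h1 (w := gradQ (fderiv ℝ H x)) fun v => by
    rw [inner_gradQ]; rfl, gradient_eq_of_hasFDerivAt h2 (w := gradP (fderiv ℝ H x)) fun v => by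
    rw [inner_gradP]; rfl]

lemma hasFDerivAt_freeH (x : Phase d) :
    HasFDerivAt freeH ((innerB x.1).comp (ContinuousLinearMap.fst ℝ (Vec d) (Vec d))) x := by
  have h1 : (freeH : Phase d → ℝ) = fun x => inner ℝ x.1 x.1 * (1 / 2 : ℝ) := by
    funext x; rw [freeH_eq]; ring
  rw [h1]
  have h2 := ((hasFDerivAt_fst (𝕜 := ℝ) (p := x)).inner ℝ
    (hasFDerivAt_fst (𝕜 := ℝ) (p := x))).mul_const (1 / 2 : ℝ)
  refine h2.congr_fderiv (ContinuousLinearMap.ext fun v => ?_)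
  simp only [smul_apply, ContinuousLinearMap.comp_apply,
    ContinuousLinearMap.prod_apply, fderivInnerCLM_apply, innerB_apply, smul_eq_mul,
    real_inner_comm x.1]
  ring

lemma contDiff_freeH : ContDiff ℝ ∞ (freeH : Phase d → ℝ) := by
  have h1 : (freeH : Phase d → ℝ) = fun x => inner ℝ x.1 x.1 * (1 / 2 : ℝ) := by
    funext x; rw [freeH_eq]; ring
  rw [h1]
  exact (contDiff_fst.inner ℝ contDiff_fst).mul contDiff_const

/-- The Hamilton equations of `H₀ + Z` have global solutions if `Z` has bounded second
derivatives. -/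
lemma exists_solution {Z HZ : Phase d → ℝ} (hZ : ContDiff ℝ ∞ Z) (hHZ : ∀ x, HZ x = freeH x + Z x)
    {B : ℝ} (hB : ∀ x, ‖iteratedFDeriv ℝ 2 Z x‖ ≤ B) (x₀ : Phase d) :
    ∃ γ : ℝ → Phase d, γ 0 = x₀ ∧ IsSolution HZ γ := by
  have hHZ' : HZ = fun x => freeH x + Z x := funext hHZ
  have hsm : ContDiff ℝ ∞ HZ := by rw [hHZ']; exact contDiff_freeH.add hZ
  have hZ' : ContDiff ℝ ∞ (fderiv ℝ Z) := hZ.fderiv_right (by simp)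
  let A : (Phase d →L[ℝ] ℝ) →L[ℝ] Phase d := (-gradQ).prod gradP
  let J : Phase d →L[ℝ] Phase d := (ContinuousLinearMap.inr ℝ (Vec d) (Vec d)).comp
    (ContinuousLinearMap.fst ℝ (Vec d) (Vec d))
  -- The free part of the field is linear and the rest is a linear image of `DZ`, which is Lipschitz
  -- by the bound on the second derivative.
  have hfield : hamField HZ = fun x => J x + A (fderiv ℝ Z x) := by
    funext x
    have h1 : fderiv ℝ HZ x = (innerB x.1).comp (ContinuousLinearMap.fst ℝ (Vec d) (Vec d)) +
        fderiv ℝ Z x := by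
      rw [hHZ']
      exact ((hasFDerivAt_freeH x).add (hZ.differentiable (by simp) x).hasFDerivAt).fderiv
    rw [hamField_eq (hsm.differentiable (by simp) x), h1]
    have h2 : gradQ ((innerB x.1).comp (ContinuousLinearMap.fst ℝ (Vec d) (Vec d))) = 0 := by
      apply ext_inner_right ℝ
      intro v
      rw [inner_gradQ]
      simp
    have h3 : gradP ((innerB x.1).comp (ContinuousLinearMap.fst ℝ (Vec d) (Vec d))) = x.1 := by
      apply ext_inner_right ℝ
      intro v
      rw [inner_gradP]
      rfl
    rw [map_add, map_add, h2, h3]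
    simp [A, J]
  have hlipZ : LipschitzWith (Real.toNNReal B) (fderiv ℝ Z) := by
    apply lipschitzWith_of_nnnorm_fderiv_le (𝕜 := ℝ) (hZ'.differentiable (by simp))
    intro x
    rw [← NNReal.coe_le_coe, coe_nnnorm]
    refine le_trans ?_ (Real.le_coe_toNNReal B)
    rw [← norm_iteratedFDeriv_one, norm_iteratedFDeriv_fderiv]
    exact hB x
  have hlip := J.lipschitz.add (A.lipschitz.comp hlipZ)
  have hsmf : ContDiff ℝ 1 fun x => J x + A (fderiv ℝ Z x) :=
    (J.contDiff.add (A.contDiff.comp hZ')).of_le (by simp)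
  obtain ⟨γ, h0, hγ⟩ := exists_global_solution hsmf hlip x₀
  refine ⟨γ, h0, fun t => ?_⟩
  rw [hfield]
  exact hγ t

/-- The actions of a solution of a Hamiltonian in normal form only drift along resonant
directions. -/
lemma inner_drift_eq_zero {δ β ε : ℝ} {Z HZ : Phase d → ℝ} (hZ : ContDiff ℝ ∞ Z)
    (hHZ : ∀ x, HZ x = freeH x + Z x) (hn : IsNormalForm δ β ε Z) (x : Phase d) (v : Vec d)
    (hv : ∀ k ∈ modes d (cutoff β ε), |dotInt k x.1| ≤ ε ^ δ → inner ℝ (intVec k) v = 0) :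
    inner ℝ (hamField HZ x).1 v = 0 := by
  obtain ⟨c, hc, hres⟩ := hn
  have hHZ' : HZ = fun x => freeH x + Z x := funext hHZ
  have hsm : ContDiff ℝ ∞ HZ := by rw [hHZ']; exact contDiff_freeH.add hZ
  -- At fixed `p` every mode that is present is constant in the direction `v`. Only values of `Z`
  -- are compared, so no regularity of the coefficients `c` is needed.
  have hconst : ∀ s : ℝ, HZ (x + s • (0, v)) = HZ x := by
    intro s
    have hx : x + s • ((0 : Vec d), v) = (x.1, x.2 + s • v) := by
      ext <;> simp
    have hZc : Z (x.1, x.2 + s • v) = Z (x.1, x.2) := by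
      have : (Z (x.1, x.2 + s • v) : ℂ) = Z (x.1, x.2) := by
        rw [hc, hc]
        refine Finset.sum_congr rfl fun k hk => ?_
        by_cases hck : c k x.1 = 0
        · simp [hck]
        have hkv : inner ℝ (intVec k) v = 0 := by
          by_cases hk0 : k = 0
          · rw [inner_intVec, hk0]; simp [dotInt]
          · exact hv k hk (hres k hk hk0 x.1 hck)
        rw [← inner_intVec, ← inner_intVec, inner_add_right, inner_smul_right, hkv, mul_zero,
          add_zero]
      exact_mod_cast this
    rw [hx, hHZ, hZc, hHZ]
    rfl
  rw [hamField_eq (hsm.differentiable (by simp) x)]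
  simp only [inner_neg_left, inner_gradQ, neg_eq_zero]
  have h2 : HasDerivAt (fun s : ℝ => x + s • ((0 : Vec d), v)) (0, v) 0 := by
    simpa using ((hasDerivAt_id (0 : ℝ)).smul_const ((0 : Vec d), v)).const_add x
  have h3 : HasFDerivAt HZ (fderiv ℝ HZ x) ((fun s : ℝ => x + s • ((0 : Vec d), v)) 0) := by
    simpa using (hsm.differentiable (by simp) x).hasFDerivAt
  have h4 := h3.comp_hasDerivAt (0 : ℝ) h2
  have h5 : (HZ ∘ fun s : ℝ => x + s • ((0 : Vec d), v)) = fun _ => HZ x := funext hconst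
  rw [h5] at h4
  exact h4.unique (hasDerivAt_const _ _)

end Dynamics

/-! ### Scaling of the actions -/

section Scaling

variable {d : ℕ}

/-- The scaling `(p, q) ↦ (r p, q)`. -/
def scale (r : ℝ) : Phase d →L[ℝ] Phase d :=
  (r • ContinuousLinearMap.id ℝ (Vec d)).prodMap (ContinuousLinearMap.id ℝ (Vec d))

lemma scale_apply (r : ℝ) (x : Phase d) : scale r x = (r • x.1, x.2) := rfl

lemma scale_scale {r s : ℝ} (h : r * s = 1) (x : Phase d) : scale r (scale s x) = x := by
  simp [scale_apply, smul_smul, h]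

lemma scale_add_angle (r : ℝ) (x : Phase d) (v : Vec d) :
    scale r (x + (0, v)) = scale r x + (0, v) := by
  simp [scale_apply]

lemma norm_scale_le {r c : ℝ} (h : |r| ≤ c) (hc : 1 ≤ c) : ‖(scale r : Phase d →L[ℝ] Phase d)‖ ≤ c := by
  apply ContinuousLinearMap.opNorm_le_bound _ (by linarith)
  intro x
  rw [scale_apply, Prod.norm_def, norm_smul, Real.norm_eq_abs]
  apply max_le
  · exact mul_le_mul h (norm_fst_le x) (norm_nonneg _) (by linarith)
  · exact (norm_snd_le x).trans (le_mul_of_one_le_left (norm_nonneg _) hc)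

lemma freeH_scale (r : ℝ) (x : Phase d) : freeH (scale r x) = r ^ 2 * freeH x := by
  rw [freeH_eq, freeH_eq, scale_apply]
  simp only [inner_smul_left, inner_smul_right, RCLike.conj_to_real]
  ring

lemma symplForm_scale (r : ℝ) (u v : Phase d) :
    symplForm (scale r u) (scale r v) = r * symplForm u v := by
  simp only [symplForm, scale_apply, inner_smul_left, inner_smul_right, RCLike.conj_to_real]
  ring

lemma norm_iteratedFDeriv_comp_scale_le {F : Type} [NormedAddCommGroup F] [NormedSpace ℝ F]
    {f : Phase d → F} (hf : ContDiff ℝ ∞ f) {r c : ℝ} (h : |r| ≤ c) (hc : 1 ≤ c) (n : ℕ)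
    (x : Phase d) :
    ‖iteratedFDeriv ℝ n (fun x => f (scale r x)) x‖ ≤ ‖iteratedFDeriv ℝ n f (scale r x)‖ * c ^ n := by
  have h1 : iteratedFDeriv ℝ n (fun x => f (scale r x)) x = _ :=
    (scale r).iteratedFDeriv_comp_right hf x (i := n) (by exact_mod_cast le_top)
  rw [h1]
  refine (ContinuousMultilinearMap.norm_compContinuousLinearMap_le _ _).trans ?_
  rw [Finset.prod_const, Finset.card_univ, Fintype.card_fin]
  gcongr
  exact norm_scale_le h hc

/-- The scaling of a function by the square of the scale, as for Hamiltonians, does not increase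
its `C²` norm. -/
lemma norm_iteratedFDeriv_scaled_le {f : Phase d → ℝ} (hf : ContDiff ℝ ∞ f) {r : ℝ} (h0 : 0 < r)
    (h1 : r ≤ 1) {a : ℝ} {n : ℕ} (hn : n ≤ 2) (ha : ∀ x, ‖iteratedFDeriv ℝ n f x‖ ≤ a)
    (x : Phase d) : ‖iteratedFDeriv ℝ n (fun x => r ^ 2 • f (scale r⁻¹ x)) x‖ ≤ a := by
  have hs : ContDiff ℝ ∞ fun x => f (scale r⁻¹ x) := hf.comp (scale r⁻¹).contDiff
  have e : iteratedFDeriv ℝ n (fun x => r ^ 2 • f (scale r⁻¹ x)) x =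
      r ^ 2 • iteratedFDeriv ℝ n (fun x => f (scale r⁻¹ x)) x :=
    iteratedFDeriv_const_smul_apply (a := r ^ 2) (f := fun x => f (scale r⁻¹ x)) (hs.contDiffAt.of_le (by exact_mod_cast le_top))
  have hinv : 1 ≤ r⁻¹ := (one_le_inv₀ h0).2 h1
  have ha0 : 0 ≤ a := (norm_nonneg _).trans (ha x)
  rw [e, norm_smul, Real.norm_eq_abs, abs_of_pos (by positivity)]
  calc r ^ 2 * ‖iteratedFDeriv ℝ n (fun x => f (scale r⁻¹ x)) x‖
      ≤ r ^ 2 * (a * r⁻¹ ^ 2) := by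
        gcongr
        refine (norm_iteratedFDeriv_comp_scale_le hf (abs_of_pos (by positivity)).le hinv n x).trans ?_
        exact mul_le_mul (ha _) (pow_le_pow_right₀ hinv hn) (by positivity) ha0
    _ = a := by field_simp

/-- Scaling multiplies the symplectic form by `r`, and conjugation cancels this factor. -/
lemma IsCanonical.scale {T : Phase d → Phase d} (hT : IsCanonical T) {r : ℝ} (hr : 0 < r) :
    IsCanonical fun x => Nekhoroshev.scale r (T (Nekhoroshev.scale r⁻¹ x)) := by
  have hr1 : r * r⁻¹ = 1 := mul_inv_cancel₀ hr.ne'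
  have hr2 : r⁻¹ * r = 1 := inv_mul_cancel₀ hr.ne'
  refine ⟨?_, ?_, ?_, ?_⟩
  · exact (Nekhoroshev.scale r).contDiff.comp (hT.smooth.comp (Nekhoroshev.scale r⁻¹).contDiff)
  · intro p q k
    have h1 : ((p, q + latticeVec k) : Phase d) = (p, q) + (0, latticeVec k) := by simp
    have h2 : ∀ x : Phase d, T (x + (0, latticeVec k)) = T x + (0, latticeVec k) := fun x => by
      have h3 : x + (0, latticeVec k) = (x.1, x.2 + latticeVec k) := by ext <;> simp
      rw [h3]
      exact hT.equivariant x.1 x.2 k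
    simp only [h1, scale_add_angle, h2]
  · obtain ⟨S, hS, hl, hrr⟩ := hT.smooth_inverse
    refine ⟨fun x => Nekhoroshev.scale r (S (Nekhoroshev.scale r⁻¹ x)),
      (Nekhoroshev.scale r).contDiff.comp (hS.comp (Nekhoroshev.scale r⁻¹).contDiff),
      fun x => ?_, fun x => ?_⟩
    · simp only [scale_scale hr2, hl _, scale_scale hr1]
    · simp only [scale_scale hr2, hrr _, scale_scale hr1]
  · intro x u v
    have h1 : HasFDerivAt (fun x => Nekhoroshev.scale r (T (Nekhoroshev.scale r⁻¹ x)))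
        ((Nekhoroshev.scale r).comp ((fderiv ℝ T (Nekhoroshev.scale r⁻¹ x)).comp
          (Nekhoroshev.scale r⁻¹))) x :=
      (ContinuousLinearMap.hasFDerivAt _).comp x
        ((hT.smooth.differentiable (by simp) _).hasFDerivAt.comp x
          (ContinuousLinearMap.hasFDerivAt _))
    rw [h1.fderiv]
    simp only [ContinuousLinearMap.comp_apply]
    rw [symplForm_scale, hT.symplectic, symplForm_scale, ← mul_assoc, hr1, one_mul]

end Scaling

end Nekhoroshev

end

noncomputable section

namespace Nekhoroshev

open scoped NNReal

/-! ### The normal form theorem -/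

section NormalForm

variable {d : ℕ}

lemma one_le_cutoff (β ε : ℝ) : 1 ≤ cutoff β ε := Nat.le_add_left 1 _

lemma inv_rpow_le_cutoff (β ε : ℝ) : 1 / ε ^ β ≤ cutoff β ε := by
  rw [cutoff, Nat.cast_add, Nat.cast_one]
  exact (Nat.lt_floor_add_one _).le

lemma cutoff_le {β ε : ℝ} (hβ : 0 ≤ β) (h0 : 0 < ε) (h1 : ε ≤ 1) :
    (cutoff β ε : ℝ) ≤ 2 * ε ^ (-β) := by
  have h2 : 1 ≤ ε ^ (-β) := Real.one_le_rpow_of_pos_of_le_one_of_nonpos h0 h1 (by linarith)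
  rw [cutoff, Nat.cast_add, Nat.cast_one, one_div, ← Real.rpow_neg h0.le]
  have := Nat.floor_le (zero_le_one.trans h2)
  linarith

lemma inv_one_add_cutoff_pow_le {β ε M : ℝ} (h0 : 0 < ε) (h1 : ε ≤ 1) {N : ℕ} (hN : M ≤ β * N) :
    ((1 + (cutoff β ε : ℝ)) ^ N)⁻¹ ≤ ε ^ M := by
  have h2 : 0 < ε ^ β := Real.rpow_pos_of_pos h0 β
  calc ((1 + (cutoff β ε : ℝ)) ^ N)⁻¹ ≤ ((1 / ε ^ β) ^ N)⁻¹ := by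
        gcongr
        linarith [inv_rpow_le_cutoff β ε]
    _ = ε ^ (β * N) := by
        rw [one_div, inv_pow, inv_inv, Real.rpow_mul h0.le, Real.rpow_natCast]
    _ ≤ ε ^ M := Real.rpow_le_rpow_of_exponent_ge h0 h1 hN

/-- Undoing the scaling turns the resonance width `1` into `ε ^ δ`; the truncation in `k` is
unaffected. -/
lemma IsNormalForm.of_scaled {δ β ε : ℝ} (h0 : 0 < ε) {Z : Phase d → ℝ}
    {c : (Fin d → ℤ) → Vec d → ℂ}
    (hc : ∀ p q : Vec d, (Z (p, q) : ℂ) =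
      ∑ k ∈ modes d (cutoff β ε), c k p * Complex.exp (Complex.I * (dotInt k q : ℂ)))
    (hres : ∀ k p, c k p ≠ 0 → |dotInt k p| ≤ 1) :
    IsNormalForm δ β ε fun x => (ε ^ δ) ^ 2 • Z (scale (ε ^ δ)⁻¹ x) := by
  have hr : 0 < ε ^ δ := Real.rpow_pos_of_pos h0 δ
  refine ⟨fun k p => ((ε ^ δ) ^ 2 : ℝ) * c k ((ε ^ δ)⁻¹ • p), fun p q => ?_,
    fun k _ _ p hk => ?_⟩
  · simp only [scale_apply, smul_eq_mul, Complex.ofReal_mul, hc, Finset.mul_sum, mul_assoc]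
  · have h1 := hres k _ (right_ne_zero_of_mul hk)
    rw [← inner_intVec, inner_smul_right, inner_intVec, abs_mul, abs_of_pos (inv_pos.2 hr),
      inv_mul_le_iff₀ hr, mul_one] at h1
    exact h1

/-- The scaling that conjugates the Hamilton–Jacobi defect to the remainder of the normal form. -/
lemma perturbedH_scale_sub {ε r μ : ℝ} (hr : 0 < r) (hε : r ^ 2 * μ = ε) (V Z : Phase d → ℝ)
    (x y : Phase d) :
    perturbedH ε V (scale r y) - (freeH x + r ^ 2 • Z (scale r⁻¹ x)) =
      r ^ 2 • (freeH y + μ * V (scale r y) - (freeH (scale r⁻¹ x) + Z (scale r⁻¹ x))) := by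
  rw [perturbedH, freeH_scale, freeH_scale, ← hε, smul_eq_mul, smul_eq_mul]
  field_simp

/-- The change of variables and the normal form obtained at a fixed `ε` from an approximate
solution of the Hamilton–Jacobi equation for the Hamiltonian in scaled actions. -/
lemma exists_canonical_of_hjDefect {ε r : ℝ} {μ : ℝ≥0} (hr : 0 < r) (hr1 : r ≤ 1)
    (hε : r ^ 2 * μ = ε) {V S Z : Phase d → ℝ} (hS : ContDiff ℝ ∞ S) (hp : PeriodicAng S)
    (hE : ContDiff ℝ ∞ (hjDefect μ (fun x => V (scale r x)) S Z))
    (hP : ∀ x, ‖fderiv ℝ (shiftP S) x‖ ≤ 1 / 2) (hQ : ∀ x, ‖fderiv ℝ (shiftQ S) x‖ ≤ 1 / 2)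
    {s B a : ℝ} (hs : ∀ x, ‖shiftP S x‖ ≤ s) (hB : ∀ x, ‖fderiv ℝ (fderiv ℝ (shiftQ S)) x‖ ≤ B)
    (ha : ∀ n ≤ 2, ∀ x, ‖iteratedFDeriv ℝ n (hjDefect μ (fun x => V (scale r x)) S Z) x‖ ≤ a) :
    ∃ T : Phase d → Phase d, IsCanonical T ∧ (∀ x, ‖(T x).1 - x.1‖ ≤ r * s) ∧
      C2NormLE (fun x => perturbedH ε V (T x) - (freeH x + r ^ 2 • Z (scale r⁻¹ x)))
        (2 * (2 + 8 * B) ^ 2 * a) := by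
  obtain ⟨T, g, hT, hg, hgr, hTg⟩ := exists_canonical hS hp hP hQ
  refine ⟨fun x => scale r (T (scale r⁻¹ x)), hT.scale hr, fun x => ?_, fun n hn x => ?_⟩
  · have h1 : (g (scale r⁻¹ x)).1 = r⁻¹ • x.1 := by
      have := congrArg Prod.fst (hgr (scale r⁻¹ x))
      simpa [shiftQ_eq, scale_apply] using this
    have h2 : (scale r (T (scale r⁻¹ x))).1 - x.1 = r • (shiftP S (g (scale r⁻¹ x))).1 := by
      rw [hTg, scale_apply, Prod.fst_add, h1, smul_add, smul_smul, mul_inv_cancel₀ hr.ne', one_smul,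
        add_sub_cancel_left]
    rw [h2, norm_smul, Real.norm_eq_abs, abs_of_pos hr]
    gcongr
    exact (norm_fst_le _).trans (hs _)
  · have h1 : (fun x => perturbedH ε V (scale r (T (scale r⁻¹ x))) -
        (freeH x + r ^ 2 • Z (scale r⁻¹ x))) = fun x => r ^ 2 •
          (fun y => hjDefect μ (fun x => V (scale r x)) S Z (g y)) (scale r⁻¹ x) := by
      funext x
      rw [perturbedH_scale_sub hr hε]
      simp only [hjDefect]
      rw [← hTg, hgr]
    rw [h1]
    exact norm_iteratedFDeriv_scaled_le (hE.comp hg) hr hr1 hn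
      (norm_iteratedFDeriv_comp_inverse_le hE ha (contDiff_shiftQ hS) hQ hB hg hgr hn) x

lemma UnifBdd.exists_forall_le_two {ι X F : Type} [NormedAddCommGroup X] [NormedSpace ℝ X]
    [NormedAddCommGroup F] [NormedSpace ℝ F] {f : ι → X → F} {η : ι → ℝ≥0} (hf : UnifBdd f η) :
    ∃ C : ℝ≥0, ∀ n ≤ 2, ∀ i x, ‖iteratedFDeriv ℝ n (f i) x‖ ≤ C * η i := by
  choose C hC using hf.bdd
  refine ⟨C 0 + C 1 + C 2, fun n hn i x => (hC n i x).trans ?_⟩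
  gcongr
  have h : C n ≤ C 0 + C 1 + C 2 := by
    interval_cases n
    · exact le_add_right (le_add_right le_rfl)
    · exact le_add_right (le_add_left le_rfl)
    · exact le_add_left le_rfl
  exact_mod_cast h

/-- The family of scaled perturbations is bounded with all derivatives. -/
lemma unifBdd_comp_scale {ι : Type} {V : Phase d → ℝ} (hV : ContDiff ℝ ∞ V) (hVb : BoundedDerivs V)
    {r : ι → ℝ} (hr : ∀ i, |r i| ≤ 1) : UnifBdd (fun i x => V (scale (r i) x)) 1 where
  smooth i := hV.comp (scale (r i)).contDiff
  bdd n := by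
    obtain ⟨C, hC⟩ := hVb n
    refine ⟨C.toNNReal, fun i x => ?_⟩
    refine (norm_iteratedFDeriv_comp_scale_le hV (hr i) le_rfl n x).trans ?_
    simpa using (hC _).trans (Real.le_coe_toNNReal C)

/-- The analytic half for all small `ε` at once. A bound on the second derivative of `Z` is enough
for global existence and may depend on `ε`. -/
lemma exists_normal_form {V : Phase d → ℝ} (hV : ContDiff ℝ ∞ V) (hVp : AnglePeriodic V)
    (hVb : BoundedDerivs V) {δ β : ℝ} (hδ0 : 0 < δ) (hδ : δ < 1 / 2) (hβ : 0 < β) (M : ℝ) :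
    ∃ C ε₀ : ℝ, 0 ≤ C ∧ 0 < ε₀ ∧ ε₀ ≤ 1 ∧ ∀ ε : ℝ, 0 < ε → ε < ε₀ →
      ∃ (T : Phase d → Phase d) (Z : Phase d → ℝ), IsCanonical T ∧ ContDiff ℝ ∞ Z ∧
        IsNormalForm δ β ε Z ∧ (∃ B, ∀ x, ‖iteratedFDeriv ℝ 2 Z x‖ ≤ B) ∧
        (∀ x, ‖(T x).1 - x.1‖ ≤ C * ε ^ (1 - δ)) ∧
        C2NormLE (fun x => perturbedH ε V (T x) - (freeH x + Z x)) (C * ε ^ M) := by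
  have hs : 0 < 1 - 2 * δ := by linarith
  -- The number of iterations and the decay order are fixed here by `μ ^ n ≤ ε ^ M` and `K ^ (-N) ≤
  -- ε ^ M`.
  obtain ⟨n, hn⟩ := exists_nat_ge (M / (1 - 2 * δ))
  obtain ⟨N, hN⟩ := exists_nat_ge (M / β)
  rw [div_le_iff₀' hs] at hn
  rw [div_le_iff₀' hβ] at hN
  -- The parameter `ε` is the index of the families, so every constant drawn from `UnifBdd` is
  -- uniform in it.
  let ι := {ε : ℝ // 0 < ε ∧ ε < 1}
  let r : ι → ℝ := fun i => i.1 ^ δ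
  let μ : ι → ℝ≥0 := fun i => ⟨i.1 ^ (1 - 2 * δ), Real.rpow_nonneg i.2.1.le _⟩
  have hμ : μ ≤ 1 := fun i => by
    rw [← NNReal.coe_le_coe]
    exact Real.rpow_le_one i.2.1.le i.2.2.le hs.le
  have hr0 : ∀ i, 0 < r i := fun i => Real.rpow_pos_of_pos i.2.1 δ
  have hr1 : ∀ i, r i ≤ 1 := fun i => Real.rpow_le_one i.2.1.le i.2.2.le hδ0.le
  have hW := unifBdd_comp_scale hV hVb (r := r) fun i => by rw [abs_of_pos (hr0 i)]; exact hr1 i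
  have hWp : ∀ i, PeriodicAng fun x => V (scale (r i) x) := fun i x k => by
    simp only [scale_add_angle]
    have h3 : scale (r i) x + (0, latticeVec k) = ((r i • x.1 : Vec d), x.2 + latticeVec k) := by
      ext <;> simp [scale_apply]
    rw [h3]
    exact hVp _ _ k
  obtain ⟨S, Z, hS, hZ, hSp, hE, hres⟩ :=
    exists_hj_solution hμ hW hWp (fun i => cutoff β i.1) n N
  obtain ⟨C₁, hC₁⟩ := hS.shiftP.norm_le
  obtain ⟨C₂, hC₂⟩ := hS.shiftP.norm_fderiv_le
  obtain ⟨C₃, hC₃⟩ := hS.shiftQ.norm_fderiv_le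
  obtain ⟨C₄, hC₄⟩ := hS.shiftQ.fderiv.norm_fderiv_le
  obtain ⟨C₅, hC₅⟩ := hE.exists_forall_le_two
  obtain ⟨C₆, hC₆⟩ := hZ.bdd 2
  have hμ' : ∀ i (C : ℝ≥0), (C : ℝ) * μ i ≤ C := fun i C =>
    mul_le_of_le_one_right C.2 (by exact_mod_cast hμ i)
  -- For `μ ≤ η` both displacements have derivative at most `1/2`, as `exists_canonical` demands.
  let η : ℝ := 1 / (2 * (1 + C₂ + C₃))
  have hη : 0 < η := by positivity
  refine ⟨C₁ + 2 * (2 + 8 * C₄) ^ 2 * (C₅ * 2), min 1 (η ^ (1 - 2 * δ)⁻¹), by positivity,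
    lt_min one_pos (Real.rpow_pos_of_pos hη _), min_le_left _ _, fun ε h0 hε => ?_⟩
  have h1 : ε < 1 := hε.trans_le (min_le_left _ _)
  let i : ι := ⟨ε, h0, h1⟩
  have hμη : (μ i : ℝ) ≤ η := by
    have h2 := Real.rpow_le_rpow h0.le (hε.le.trans (min_le_right _ _)) hs.le
    rwa [← Real.rpow_mul hη.le, inv_mul_cancel₀ hs.ne', Real.rpow_one] at h2
  have hsmall : ∀ C : ℝ≥0, C ≤ 1 + C₂ + C₃ → (C : ℝ) * μ i ≤ 1 / 2 := fun C hC => by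
    have hC' : (C : ℝ) ≤ 1 + C₂ + C₃ := by exact_mod_cast hC
    calc (C : ℝ) * μ i ≤ (1 + C₂ + C₃) * η := by gcongr
      _ = 1 / 2 := by simp only [η]; field_simp
  have hrμ : r i ^ 2 * μ i = ε := by
    change (ε ^ δ) ^ 2 * ε ^ (1 - 2 * δ) = ε
    rw [← Real.rpow_mul_natCast h0.le, ← Real.rpow_add h0]
    norm_num
    rw [show δ * 2 + (1 - 2 * δ) = 1 by ring, Real.rpow_one]
  have hrμ' : r i * μ i = ε ^ (1 - δ) := by
    change ε ^ δ * ε ^ (1 - 2 * δ) = _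
    rw [← Real.rpow_add h0]
    ring_nf
  have hdef : ((μ i ^ n + ((1 + (cutoff β i.1 : ℝ≥0)) ^ N)⁻¹ : ℝ≥0) : ℝ) ≤ 2 * ε ^ M := by
    have h2 : (μ i : ℝ) ^ n ≤ ε ^ M := by
      change (ε ^ (1 - 2 * δ)) ^ n ≤ _
      rw [← Real.rpow_mul_natCast h0.le]
      exact Real.rpow_le_rpow_of_exponent_ge h0 h1.le hn
    have h3 := inv_one_add_cutoff_pow_le h0 h1.le hN
    push_cast
    change (μ i : ℝ) ^ n + ((1 + (cutoff β ε : ℝ)) ^ N)⁻¹ ≤ _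
    linarith
  obtain ⟨T, hT, hT1, hT2⟩ := exists_canonical_of_hjDefect (hr0 i) (hr1 i) hrμ (hS.smooth i)
    (hSp i) (hE.smooth i) (fun x => (hC₂ i x).trans (hsmall C₂ (by
      exact le_add_right (le_add_left le_rfl)))) (fun x => (hC₃ i x).trans (hsmall C₃ (by
      exact le_add_left le_rfl))) (hC₁ i) (fun x => (hC₄ i x).trans (hμ' i C₄))
    (fun n hn x => (hC₅ n hn i x).trans (mul_le_mul_of_nonneg_left hdef C₅.2))
  obtain ⟨c, hc, hcr⟩ := hres i
  have hM0 : 0 < ε ^ M := Real.rpow_pos_of_pos h0 M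
  refine ⟨T, fun x => r i ^ 2 • Z i (scale (r i)⁻¹ x), hT,
    ((hZ.smooth i).comp (scale (r i)⁻¹).contDiff).const_smul (r i ^ 2),
    IsNormalForm.of_scaled h0 hc hcr,
    ⟨C₆ * μ i, norm_iteratedFDeriv_scaled_le (hZ.smooth i) (hr0 i) (hr1 i) le_rfl (hC₆ i)⟩,
    fun x => (hT1 x).trans ?_, fun n hn x => (hT2 n hn x).trans ?_⟩
  · rw [mul_left_comm, hrμ']
    gcongr
    have : (0 : ℝ) ≤ 2 * (2 + 8 * C₄) ^ 2 * (C₅ * 2) := by positivity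
    linarith
  · have h2 : (0 : ℝ) ≤ C₁ * ε ^ M := by positivity
    linarith

end NormalForm

end Nekhoroshev

end

/-! ### Choice of the exponents and conclusion. -/

open Nekhoroshev in
theorem theorem1p2 (d : ℕ) (b : ℝ) (hb0 : 0 < b) (hb : b < 1 / 2) :
    ∃ δ β : ℝ, 0 < δ ∧ δ < 1 / 2 ∧ 0 < β ∧ β < 1 ∧
      ∀ V : Nekhoroshev.Phase d → ℝ, ContDiff ℝ ∞ V → Nekhoroshev.AnglePeriodic V →
        Nekhoroshev.BoundedDerivs V →
      ∀ M : ℝ, 0 < M → ∃ C ε₀ : ℝ, 0 < C ∧ 0 < ε₀ ∧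
        ∀ ε : ℝ, 0 < ε → ε < ε₀ →
          ∃ (T : Nekhoroshev.Phase d → Nekhoroshev.Phase d) (Z HZ : Nekhoroshev.Phase d → ℝ),
            Nekhoroshev.IsCanonical T ∧
            ContDiff ℝ ∞ Z ∧ Nekhoroshev.IsNormalForm δ β ε Z ∧
            (∀ x, HZ x = Nekhoroshev.freeH x + Z x) ∧
            (∀ x, ‖(T x).1 - x.1‖ ≤ C * ε ^ b) ∧
            Nekhoroshev.C2NormLE
              (fun x => Nekhoroshev.perturbedH ε V (T x) - HZ x) (C * ε ^ M) ∧
            (∀ x₀, ∃ γ : ℝ → Nekhoroshev.Phase d, γ 0 = x₀ ∧ Nekhoroshev.IsSolution HZ γ) ∧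
            (∀ γ : ℝ → Nekhoroshev.Phase d, Nekhoroshev.IsSolution HZ γ →
              ∀ t : ℝ, ‖(γ t).1 - (γ 0).1‖ ≤ C * ε ^ b) := by
  obtain ⟨D, hD0, hD⟩ := exists_drift_bound d
  let a : ℕ := (2 * d + 2) * d
  -- The midpoint of `b` and `1/2`: `δ < 1/2` makes `μ` small, and `b < δ` leaves room for the
  -- powers of `K` in the drift bound.
  let δ : ℝ := (b + 1 / 2) / 2
  -- The loss `K ^ a ~ ε ^ (-β a)` must not exceed `ε ^ (b - δ)`. The denominator is `a + 1` because
  -- `a = 0` when `d = 0`.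
  let β : ℝ := min (1 / 2) ((δ - b) / (a + 1))
  have hδb : b < δ := by simp only [δ]; linarith
  have hδ : δ < 1 / 2 := by simp only [δ]; linarith
  have hβ0 : 0 < β := lt_min (by norm_num) (div_pos (by linarith) (by positivity))
  have hβ1 : β < 1 := (min_le_left _ _).trans_lt (by norm_num)
  have hβa : b ≤ δ - β * a := by
    have h1 : β * (a + 1) ≤ δ - b := by
      rw [← le_div_iff₀ (by positivity)]; exact min_le_right _ _
    linarith
  refine ⟨δ, β, hb0.trans hδb, hδ, hβ0, hβ1, fun V hV hVp hVb M _ => ?_⟩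
  obtain ⟨C, ε₀, hC0, hε0, hε1, h⟩ := exists_normal_form hV hVp hVb (hb0.trans hδb) hδ hβ0 M
  refine ⟨C + D * 2 ^ a, ε₀, by positivity, hε0, fun ε h0 hε => ?_⟩
  obtain ⟨T, Z, hT, hZ, hn, ⟨B, hB⟩, hT1, hT2⟩ := h ε h0 hε
  have h1 : ε ≤ 1 := hε.le.trans hε1
  have hεb : 0 < ε ^ b := Real.rpow_pos_of_pos h0 b
  have hDa : 0 < D * 2 ^ a := by positivity
  refine ⟨T, Z, fun x => freeH x + Z x, hT, hZ, hn, fun _ => rfl, fun x => (hT1 x).trans ?_,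
    fun n hn x => (hT2 n hn x).trans ?_, exists_solution hZ (fun _ => rfl) hB, fun γ hγ t => ?_⟩
  -- Here `1 - δ > 1/2 > b`.
  · have h2 : ε ^ (1 - δ) ≤ ε ^ b := Real.rpow_le_rpow_of_exponent_ge h0 h1 (by linarith)
    gcongr
    linarith
  · have h2 : 0 < ε ^ M := Real.rpow_pos_of_pos h0 M
    gcongr
    linarith
  · have hfst : ∀ t, HasDerivAt (fun t => (γ t).1) (hamField (fun x => freeH x + Z x) (γ t)).1 t :=
      fun t => (ContinuousLinearMap.fst ℝ (Vec d) (Vec d)).hasFDerivAt.comp_hasDerivAt t (hγ t)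
    refine (hD (cutoff β ε) (one_le_cutoff β ε) (ε ^ δ) (Real.rpow_pos_of_pos h0 δ) _ _ hfst
      (fun t v hv => inner_drift_eq_zero hZ (fun _ => rfl) hn (γ t) v hv) t).trans ?_
    calc D * (cutoff β ε : ℝ) ^ a * ε ^ δ ≤ D * (2 * ε ^ (-β)) ^ a * ε ^ δ := by
          gcongr
          exact cutoff_le hβ0.le h0 h1
      _ = D * 2 ^ a * ε ^ (δ - β * a) := by
          rw [mul_pow, ← Real.rpow_mul_natCast h0.le, sub_eq_add_neg, Real.rpow_add h0]
          ring_nf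
      _ ≤ (C + D * 2 ^ a) * ε ^ b := by
          have h2 := Real.rpow_le_rpow_of_exponent_ge h0 h1 hβa
          gcongr
          linarith
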